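/- Let $(\mathcal C,J)$ be a site and work in the topos of $J$-sheaves on $\mathcal C$; all of the following is understood internally (existence and disjunction mean existence and disjunction on a cover). A *non negative upper real* is an inhabited, open, upward closed set $U$ of positive rationals; we write $U<q$ for $q\in U$, put $U_1\leqslant U_2$ iff $U_2\subseteq U_1$, let $U_1+U_2$ and $U_1U_2$ be the sets of all $r_1+r_2$, respectively $r_1r_2$, with $r_i\in U_i$, and identify a rational $c\geqslant 0$ with $\{q : q>c\}$. A *commutative C\*-algebra* $A$ is a commutative unital $*$-algebra over $\mathbb Q[i]$ (with conjugate-linear involution) together with a map $\|\cdot\|$ from $A$ to the non negative upper reals such that $$\|0\|=0,\quad \|1\|=1,\quad \|a^*\|=\|a\|,\quad \|ab\|\leqslant\|a\|\|b\|,\quad \|ra\|=|r|\|a\|\ (r\in\mathbb Q),\quad \|a+b\|\leqslant\|a\|+\|b\|,\quad \|aa^*\|=\|a\|^2,$$ and such that every Cauchy approximation has a unique limit. Here a Cauchy approximation is a sequence $(C_n)$ of inhabited subsets of $A$ such that for every rational $\varepsilon>0$ there is $m$ with $\|a-a'\|<\varepsilon$ whenever $n,n'\geqslant m$, $a\in C_n$,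 $a'\in C_{n'}$; and $b$ is a limit of it if for every rational $\varepsilon>0$ there is $m$ with $\|a-b\|<\varepsilon$ whenever $n\geqslant m$ and $a\in C_n$. Present the locale $\mathbb C$ by the rational open rectangles $R$ as generators, with the relations $\top\leqslant\bigvee_R R$; $R\wedge R'\leqslant R\cap R'$; $R\leqslant P_1\vee\dots\vee P_n$ if $R\subseteq P_1\cup\dots\cup P_n$; and $R\leqslant\bigvee\{R' : R'\text{ well inside }R\}$. Let $\mathsf{MFn}(A)$ be the locale of multiplicative functionals on $A$: it is generated by symbols $a\in R$ ($a\in A$, $R$ a rational open rectangle), subject to the above relations for each fixed $a$ (so that $a$ defines a map to $\mathbb C$) and to the relations $$\top\leqslant (z\cdot 1\in R)\ \text{ for } z\in\mathbb Q[i],\ z\in R;\qquad (a\in R)\leqslant(a^*\in P)\ \text{ if } \overline R\subseteq P,\ \overline R=\{\bar z : z\in R\};$$ $$(a\in R)\wedge(b\in R')\leqslant(a+b\in P)\ \text{ if } R+R'\subseteq P;\qquad (a\in R)\wedge(b\in R')\leqslant(ab\in P)\ \text{ if } R\cdot R'\subseteq P.$$ The *Gelfand transform* of $b\in A$ is the map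 of locales $\hat b:\mathsf{MFn}(A)\to\mathbb C$ with $\hat b^{-1}(R)=(b\in R)$ for every rational open rectangle $R$, and $\|\hat b\|$ is determined by: $\|\hat b\|<q$ iff $\hat b^{-1}(\{z : |z|<q\})=\top$, for $q$ a positive rational. **Theorem 5.1.** Let $A$ be a commutative C\*-algebra in the topos of $J$-sheaves on $\mathcal C$. The Gelfand transform is norm-preserving: $\|b\|=\|\hat b\|$ for every $b\in A$, as an equality of (sets of positive rationals defining) non negative upper reals in the topos. -/

import Mathlib

open CategoryTheory Opposite

universe w v u

set_option linter.unusedVariables false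

namespace ToposGelfand

/-! ### Rational numbers, complex rationals and rational rectangles -/

/-- Positive rational numbers. -/
abbrev PosRat : Type := {q : ℚ // 0 < q}

/-- The ring `ℚ[i]` of complex rationals, with conjugation as its `star`. -/
abbrev CRat : Type := QuadraticAlgebra ℚ (-1) 0

/-- A rational open rectangle `(r, s)` of the complex plane, given by its lower left corner `r` and
its upper right corner `s`.  It is empty unless `r.re < s.re` and `r.im < s.im`. -/
@[ext] structure Rect : Type where
  lo : CRat
  hi : CRat

namespace Rect

/-- The complex rationals that lie in a rectangle. -/
def pts (R : Rect) : Set CRat :=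
  {z | R.lo.re < z.re ∧ z.re < R.hi.re ∧ R.lo.im < z.im ∧ z.im < R.hi.im}

/-- The intersection of two rectangles. -/
def inter (R R' : Rect) : Rect :=
  ⟨⟨max R.lo.re R'.lo.re, max R.lo.im R'.lo.im⟩, ⟨min R.hi.re R'.hi.re, min R.hi.im R'.hi.im⟩⟩

/-- `R'` is well inside `R`: each side of `R'` is strictly inside the matching side of `R`. -/
def WellInside (R' R : Rect) : Prop :=
  R.lo.re < R'.lo.re ∧ R'.hi.re < R.hi.re ∧ R.lo.im < R'.lo.im ∧ R'.hi.im < R.hi.im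

/-- The relations that present the locale `ℂ` of complex numbers on the generators `R`, a rational
open rectangle.  `Rel g m S` is the relation `⋀ m ≤ ⋁ {⋀ l | l ∈ S}`, written with the name `g R`
for the generator `R`. -/
inductive Rel {G : Type*} (g : Rect → G) : List G → Set (List G) → Prop
  /-- `⊤ ≤ ⋁ R` -/
  | total : Rel g [] {l | ∃ R, l = [g R]}
  /-- `R ∧ R' ≤ R ∩ R'` -/
  | inter (R R' : Rect) : Rel g [g R, g R'] {[g (R.inter R')]}
  /-- `R ≤ P₁ ∨ ⋯ ∨ Pₙ` if the rectangle `R` is contained in the union of the `Pᵢ` -/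
  | cover (R : Rect) (L : List Rect) (h : ∀ z ∈ R.pts, ∃ P ∈ L, z ∈ P.pts) :
      Rel g [g R] {l | ∃ P ∈ L, l = [g P]}
  /-- `R ≤ ⋁ {R' | R' well inside R}` -/
  | inner (R : Rect) : Rel g [g R] {l | ∃ R' : Rect, R'.WellInside R ∧ l = [g R']}

theorem Rel.map {G G' : Type*} {g : Rect → G} (φ : G → G') {m : List G} {S : Set (List G)}
    (h : Rel g m S) : Rel (fun R => φ (g R)) (m.map φ) (List.map φ '' S) := by
  cases h with
  | total =>
    have e : List.map φ '' {l | ∃ R, l = [g R]} = {l | ∃ R, l = [φ (g R)]} := by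
      ext l
      constructor
      · rintro ⟨_, ⟨R, rfl⟩, rfl⟩
        exact ⟨R, rfl⟩
      · rintro ⟨R, rfl⟩
        exact ⟨_, ⟨R, rfl⟩, rfl⟩
    rw [e]
    exact Rel.total
  | inter R R' =>
    rw [Set.image_singleton]
    exact Rel.inter (g := fun R => φ (g R)) R R'
  | cover R L hL =>
    have e : List.map φ '' {l | ∃ P ∈ L, l = [g P]} = {l | ∃ P ∈ L, l = [φ (g P)]} := by
      ext l
      constructor
      · rintro ⟨_, ⟨P, hP, rfl⟩, rfl⟩
        exact ⟨P, hP, rfl⟩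
      · rintro ⟨P, hP, rfl⟩
        exact ⟨_, ⟨P, hP, rfl⟩, rfl⟩
    rw [e]
    exact Rel.cover (g := fun R => φ (g R)) R L hL
  | inner R =>
    have e : List.map φ '' {l | ∃ R' : Rect, R'.WellInside R ∧ l = [g R']} =
        {l | ∃ R' : Rect, R'.WellInside R ∧ l = [φ (g R')]} := by
      ext l
      constructor
      · rintro ⟨_, ⟨P, hP, rfl⟩, rfl⟩
        exact ⟨P, hP, rfl⟩
      · rintro ⟨P, hP, rfl⟩
        exact ⟨_, ⟨P, hP, rfl⟩, rfl⟩
    rw [e]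
    exact Rel.inner (g := fun R => φ (g R)) R

end Rect

variable {C : Type u} [Category.{v} C]

/-! ### Non negative upper reals in the topos of sheaves on a site

Truth values at stage `U` are the `J`-closed sieves on `U`, and a set of positive rationals at
stage `U` (a subsheaf over `U` of the constant sheaf of positive rationals) is a family of closed
sieves indexed by the positive rationals. -/

/-- The truth value at stage `U` of an external proposition (that is, of a statement about
constant sheaves, such as an inequality between two rational numbers). -/
def truth (J : GrothendieckTopology C) (U : C) (p : Prop) : Sieve U :=
  J.close { arrows := fun _ _ => p, downward_closed := fun h _ => h }

/-- Non negative upper reals at stage `U`: inhabited open upward closed sets of positive rationals.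
`x.lt q` is the truth value of `x < q`. -/
@[ext] structure UpperReal (J : GrothendieckTopology C) (U : C) where
  lt : PosRat → Sieve U
  closed : ∀ q, J.IsClosed (lt q)
  upward : ∀ q q', q ≤ q' → lt q ≤ lt q'
  rounded : ∀ q, lt q ≤ J.close (⨆ r : {r : PosRat // r < q}, lt r.1)
  inhabited : J.close (⨆ q, lt q) = ⊤

namespace UpperReal

variable {J : GrothendieckTopology C} {U V : C}

theorem le_iSup_apply {ι : Sort*} (s : ι → Sieve U) (i : ι) (f : V ⟶ U) (h : s i f) :
    (⨆ i, s i) f := le_iSup s i _ h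

/-- Restriction of an upper real to a later stage. -/
def res (x : UpperReal J U) (f : V ⟶ U) : UpperReal J V where
  lt q := (x.lt q).pullback f
  closed q := J.isClosed_pullback f _ (x.closed q)
  upward q q' h := Sieve.pullback_monotone f (x.upward q q' h)
  rounded q := by
    refine (Sieve.pullback_monotone f (x.rounded q)).trans ?_
    rw [← J.pullback_close]
    refine J.monotone_close ?_
    rintro W g ⟨_, ⟨r, rfl⟩, hg⟩
    exact le_iSup_apply (fun r : {r : PosRat // r < q} => (x.lt r.1).pullback f) r g hg
  inhabited := by
    have h := congrArg (Sieve.pullback f) x.inhabited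
    rw [← J.pullback_close, Sieve.pullback_top, _root_.eq_top_iff] at h
    refine _root_.eq_top_iff.2 (h.trans (J.monotone_close ?_))
    rintro W g ⟨_, ⟨r, rfl⟩, hg⟩
    exact le_iSup_apply (fun r : PosRat => (x.lt r).pullback f) r g hg

/-- `x ≤ y` means that, as sets of rationals, `y` is a subset of `x`. -/
instance : LE (UpperReal J U) := ⟨fun x y => ∀ q, y.lt q ≤ x.lt q⟩

/-- The set of all `op r s` with `r ∈ x` and `s ∈ y`. -/
def image₂ (op : PosRat → PosRat → PosRat) (x y : UpperReal J U) (q : PosRat) : Sieve U :=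
  J.close (⨆ p : {p : PosRat × PosRat // op p.1 p.2 = q}, x.lt p.1.1 ⊓ y.lt p.1.2)

theorem image₂_of (op : PosRat → PosRat → PosRat) (x y : UpperReal J U) {r s q : PosRat}
    (h : op r s = q) {f : V ⟶ U} (hx : x.lt r f) (hy : y.lt s f) : image₂ op x y q f :=
  J.le_close _ _ (le_iSup_apply
    (fun p : {p : PosRat × PosRat // op p.1 p.2 = q} => x.lt p.1.1 ⊓ y.lt p.1.2)
    ⟨(r, s), h⟩ f ⟨hx, hy⟩)

theorem image₂_le (op : PosRat → PosRat → PosRat) (x y : UpperReal J U) (q : PosRat) (S : Sieve U)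
    (hS : J.IsClosed S)
    (h : ∀ r s, op r s = q → ∀ ⦃V : C⦄ (f : V ⟶ U), x.lt r f → y.lt s f → S f) :
    image₂ op x y q ≤ S := by
  refine J.le_close_of_isClosed (iSup_le ?_) hS
  rintro ⟨⟨r, s⟩, hp⟩ V f ⟨hx, hy⟩
  exact h r s hp f hx hy

/-- A binary operation on upper reals from one on rationals that is strictly monotone in the second
argument and can be solved for it above a given value. -/
def map₂ (op : PosRat → PosRat → PosRat) (hop : ∀ r s s', s' < s → op r s' < op r s)
    (hsol : ∀ r s q, op r s ≤ q → ∃ s', s ≤ s' ∧ op r s' = q) (x y : UpperReal J U) :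
    UpperReal J U where
  lt := image₂ op x y
  closed q := J.close_isClosed _
  upward q q' h := by
    refine image₂_le op x y q _ (J.close_isClosed _) ?_
    rintro r s rfl V f hx hy
    obtain ⟨s', hs, e⟩ := hsol r s q' h
    exact image₂_of op x y e hx (y.upward s s' hs _ hy)
  rounded q := by
    refine image₂_le op x y q _ (J.close_isClosed _) ?_
    rintro r s rfl V f hx hy
    refine J.superset_covering ?_ (J.intersection_covering
      (J.pullback_stable f (J.top_mem U)) (y.rounded s f hy))
    rintro W g ⟨-, _, ⟨s', rfl⟩, hg⟩
    refine le_iSup_apply (fun t : {t : PosRat // t < op r s} => image₂ op x y t.1)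
      ⟨op r s'.1, hop _ _ _ s'.2⟩ _ ?_
    exact image₂_of op x y rfl ((x.lt r).downward_closed hx g) hg
  inhabited := by
    have hx := (J.close_eq_top_iff_mem _).1 x.inhabited
    have hy := (J.close_eq_top_iff_mem _).1 y.inhabited
    refine (J.close_eq_top_iff_mem _).2 (J.superset_covering ?_ (J.intersection_covering hx hy))
    rintro W g ⟨⟨_, ⟨r, rfl⟩, hr⟩, ⟨_, ⟨s, rfl⟩, hs⟩⟩
    exact le_iSup_apply (fun q => image₂ op x y q) (op r s) g (image₂_of op x y rfl hr hs)

instance : Add (UpperReal J U) :=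
  ⟨map₂ (fun r s => r + s) (fun r s s' h => by simpa using h) (fun r s q h => by
    have h' : r.1 + s.1 ≤ q.1 := h
    have hs := s.2
    exact ⟨⟨q.1 - r.1, by linarith⟩, show s.1 ≤ q.1 - r.1 by linarith, Subtype.ext (by simp)⟩)⟩

instance : Mul (UpperReal J U) :=
  ⟨map₂ (fun r s => r * s) (fun r s s' h => by simpa using h) (fun r s q h => by
    have h' : r.1 * s.1 ≤ q.1 := h
    have hr := r.2
    refine ⟨⟨q.1 / r.1, div_pos q.2 hr⟩, show s.1 ≤ q.1 / r.1 from ?_, Subtype.ext ?_⟩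
    · rw [le_div_iff₀ hr]; linarith
    · exact mul_div_cancel₀ _ hr.ne')⟩

/-- A non negative rational `c`, as the set of positive rationals `q` with `c < q`. -/
def ofRat (J : GrothendieckTopology C) (U : C) (c : ℚ) : UpperReal J U where
  lt q := truth J U (c < q.1)
  closed q := J.close_isClosed _
  upward q q' h := J.monotone_close fun _ _ hf => lt_of_lt_of_le hf h
  rounded q := by
    refine J.monotone_close ?_
    intro V f hf
    have hf' : c < q.1 := hf
    have hm : max c 0 < q.1 := max_lt hf' q.2
    obtain ⟨t, h1, h2⟩ := exists_between hm
    have ht : 0 < t := lt_of_le_of_lt (le_max_right _ _) h1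
    exact le_iSup_apply (fun r : {r : PosRat // r < q} => truth J U (c < r.1.1)) ⟨⟨t, ht⟩, h2⟩ f
      (J.le_close _ _ (lt_of_le_of_lt (le_max_left _ _) h1))
  inhabited := by
    refine _root_.eq_top_iff.2 fun V f _ => J.le_close _ _ ?_
    have h0 : (0 : ℚ) ≤ |c| := abs_nonneg c
    have h1 : c ≤ |c| := le_abs_self c
    exact le_iSup_apply (fun q : PosRat => truth J U (c < q.1)) ⟨|c| + 1, by linarith⟩ f
      (J.le_close _ _ (show c < |c| + 1 by linarith))

end UpperReal

/-! ### Commutative C*-algebras in the topos of sheaves on a site -/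

/-- A commutative seminormed `*`-algebra over the complex rationals, in the topos of `J`-sheaves,
whose seminorm is valued in the non negative upper reals and satisfies the C*-identities. -/
structure CStarSeminormed (J : GrothendieckTopology C) where
  /-- the underlying sheaf of commutative `ℚ[i]`-algebras -/
  alg : Cᵒᵖ ⥤ CommAlgCat.{w} CRat
  isSheaf : Presieve.IsSheaf J (alg ⋙ forget (CommAlgCat.{w} CRat))
  /-- the involution -/
  starRing : ∀ U : Cᵒᵖ, StarRing (alg.obj U)
  star_smul : ∀ (U : Cᵒᵖ) (z : CRat) (a : alg.obj U), star (z • a) = star z • star a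
  star_res : ∀ {U V : C} (f : V ⟶ U) (a : alg.obj (op U)),
    (alg.map f.op).hom (star a) = star ((alg.map f.op).hom a)
  /-- the norm, a map from the algebra to the upper reals -/
  norm : ∀ {U : C}, alg.obj (op U) → UpperReal J U
  norm_res : ∀ {U V : C} (f : V ⟶ U) (a : alg.obj (op U)),
    norm ((alg.map f.op).hom a) = (norm a).res f
  norm_zero : ∀ U : C, norm (0 : alg.obj (op U)) = UpperReal.ofRat J U 0
  norm_one : ∀ U : C, norm (1 : alg.obj (op U)) = UpperReal.ofRat J U 1
  norm_star : ∀ {U : C} (a : alg.obj (op U)), norm (star a) = norm a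
  norm_mul : ∀ {U : C} (a b : alg.obj (op U)), norm (a * b) ≤ norm a * norm b
  norm_smul : ∀ {U : C} (r : ℚ) (a : alg.obj (op U)),
    norm (algebraMap ℚ CRat r • a) = UpperReal.ofRat J U |r| * norm a
  norm_add : ∀ {U : C} (a b : alg.obj (op U)), norm (a + b) ≤ norm a + norm b
  norm_mul_star : ∀ {U : C} (a : alg.obj (op U)), norm (a * star a) = norm a * norm a

attribute [instance] CStarSeminormed.starRing

namespace CStarSeminormed

variable {J : GrothendieckTopology C} (A : CStarSeminormed.{w} J)

/-- The elements of the algebra at stage `U`. -/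
abbrev El (U : C) : Type w := A.alg.obj (op U)

/-- Restriction of elements to a later stage. -/
abbrev res {U V : C} (f : V ⟶ U) : A.El U →ₐ[CRat] A.El V := (A.alg.map f.op).hom

/-- `‖a‖ < q` holds at stage `U`. -/
def NormLT {U : C} (a : A.El U) (q : PosRat) : Prop := (A.norm a).lt q (𝟙 U)

/-- A Cauchy approximation on `A` at stage `U`: a sequence of inhabited subsets `Cₙ` of `A` (that
is, subsheaves of `A` over `U`) such that for every positive rational `ε` there is `m` with
`‖a - a'‖ < ε` for all `n, n' ≥ m`, `a ∈ Cₙ` and `a' ∈ Cₙ'`.  Existence means, as always in a sheaf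
topos, existence on a cover. -/
structure CauchyApprox (U : C) where
  mem : ℕ → ∀ ⦃V : C⦄, (V ⟶ U) → A.El V → Prop
  mem_res : ∀ n ⦃V W : C⦄ (f : V ⟶ U) (g : W ⟶ V) (a : A.El V),
    mem n f a → mem n (g ≫ f) (A.res g a)
  mem_glue : ∀ n ⦃V : C⦄ (f : V ⟶ U) (a : A.El V) (S : Sieve V), S ∈ J V →
    (∀ ⦃W : C⦄ (g : W ⟶ V), S g → mem n (g ≫ f) (A.res g a)) → mem n f a
  inhabited : ∀ n, ∃ S ∈ J U, ∀ ⦃V : C⦄ (f : V ⟶ U), S f → ∃ a, mem n f a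
  cauchy : ∀ ε : PosRat, ∃ S ∈ J U, ∀ ⦃V : C⦄ (f : V ⟶ U), S f → ∃ m, ∀ n ≥ m, ∀ n' ≥ m,
    ∀ ⦃W : C⦄ (g : W ⟶ V) (a a' : A.El W),
      mem n (g ≫ f) a → mem n' (g ≫ f) a' → A.NormLT (a - a') ε

/-- `b` is a limit of the Cauchy approximation `c`: for every positive rational `ε` there is `m`
with `‖a - b‖ < ε` for all `n ≥ m` and `a ∈ Cₙ`. -/
def CauchyApprox.Converges {A : CStarSeminormed.{w} J} {U : C} (c : A.CauchyApprox U)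
    (b : A.El U) : Prop :=
  ∀ ε : PosRat, ∃ S ∈ J U, ∀ ⦃V : C⦄ (f : V ⟶ U), S f → ∃ m, ∀ n ≥ m,
    ∀ ⦃W : C⦄ (g : W ⟶ V) (a : A.El W),
      c.mem n (g ≫ f) a → A.NormLT (a - A.res (g ≫ f) b) ε

end CStarSeminormed

/-- A commutative C*-algebra in the topos of `J`-sheaves: it is moreover complete, in the sense
that every Cauchy approximation, at any stage, has a unique limit. -/
structure CommCStarAlgebra (J : GrothendieckTopology C) extends CStarSeminormed.{w} J where
  complete : ∀ (U : C) (c : toCStarSeminormed.CauchyApprox U), ∃! b, c.Converges b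

/-! ### Locales presented by generators and relations in the topos of sheaves on a site -/

/-- Generators and relations for a locale in the topos of `J`-sheaves.  `Rel m S` is the relation
`⋀ m ≤ ⋁ {⋀ l | l ∈ S}` between generators at stage `U`. -/
structure Presentation (C : Type u) [Category.{v} C] where
  Gen : Cᵒᵖ ⥤ Type w
  Rel : ∀ U : C, List (Gen.obj (op U)) → Set (List (Gen.obj (op U))) → Prop
  rel_res : ∀ {U V : C} (f : V ⟶ U) (m : List (Gen.obj (op U))) (S : Set (List (Gen.obj (op U)))),
    Rel U m S → Rel V (m.map (Gen.map f.op)) ((List.map (Gen.map f.op)) '' S)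

namespace Presentation

variable (X : Presentation.{w} C)

/-- Finite sets of generators at stage `U`, as lists; `l` stands for the open `⋀ l`. -/
abbrev Fin (U : C) : Type w := List (X.Gen.obj (op U))

/-- Restriction to a later stage. -/
abbrev res {U V : C} (f : V ⟶ U) : X.Fin U → X.Fin V := List.map (X.Gen.map f.op)

/-- The opens at stage `U` of the locale presented by `X`.  As usual, the frame that is presented by
generators and relations is the frame of those sets of finite meets of generators that are
downward closed and closed under the coverage given by the relations (ideals of the coverage);
here such a set is a subsheaf over `U` of the sheaf of finite sets of generators. -/
@[ext] structure Opens (J : GrothendieckTopology C) (U : C) where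
  mem : ∀ ⦃V : C⦄, (V ⟶ U) → X.Fin V → Prop
  mem_res : ∀ ⦃V W : C⦄ (f : V ⟶ U) (g : W ⟶ V) (l : X.Fin V), mem f l → mem (g ≫ f) (X.res g l)
  mem_glue : ∀ ⦃V : C⦄ (f : V ⟶ U) (l : X.Fin V) (S : Sieve V), S ∈ J V →
    (∀ ⦃W : C⦄ (g : W ⟶ V), S g → mem (g ≫ f) (X.res g l)) → mem f l
  mem_mono : ∀ ⦃V : C⦄ (f : V ⟶ U) (l l' : X.Fin V), l ⊆ l' → mem f l → mem f l'
  mem_cover : ∀ ⦃V : C⦄ (f : V ⟶ U) (m n : X.Fin V) (S : Set (X.Fin V)), X.Rel V m S →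
    (∀ l ∈ S, mem f (l ++ n)) → mem f (m ++ n)

namespace Opens

variable {X} {J : GrothendieckTopology C} {U : C}

instance : PartialOrder (X.Opens J U) where
  le O P := ∀ ⦃V : C⦄ (f : V ⟶ U) (l : X.Fin V), O.mem f l → P.mem f l
  le_refl O V f l h := h
  le_trans O P Q h h' V f l hl := h' f l (h f l hl)
  le_antisymm O P h h' := by
    ext V f l
    exact ⟨h f l, h' f l⟩

instance : InfSet (X.Opens J U) where
  sInf s :=
    { mem := fun V f l => ∀ O ∈ s, O.mem f l
      mem_res := fun V W f g l h O hO => O.mem_res f g l (h O hO)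
      mem_glue := fun V f l S hS h O hO => O.mem_glue f l S hS fun W g hg => h g hg O hO
      mem_mono := fun V f l l' hl h O hO => O.mem_mono f l l' hl (h O hO)
      mem_cover := fun V f m n S hS h O hO => O.mem_cover f m n S hS fun l hl => h l hl O hO }

instance : Min (X.Opens J U) where
  min O P :=
    { mem := fun V f l => O.mem f l ∧ P.mem f l
      mem_res := fun V W f g l h => ⟨O.mem_res f g l h.1, P.mem_res f g l h.2⟩
      mem_glue := fun V f l S hS h => ⟨O.mem_glue f l S hS fun W g hg => (h g hg).1,
        P.mem_glue f l S hS fun W g hg => (h g hg).2⟩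
      mem_mono := fun V f l l' hl h => ⟨O.mem_mono f l l' hl h.1, P.mem_mono f l l' hl h.2⟩
      mem_cover := fun V f m n S hS h => ⟨O.mem_cover f m n S hS fun l hl => (h l hl).1,
        P.mem_cover f m n S hS fun l hl => (h l hl).2⟩ }

instance : CompleteLattice (X.Opens J U) :=
  { completeLatticeOfInf (X.Opens J U) fun s =>
      ⟨fun O hO V f l h => h O hO, fun P hP V f l h O hO => hP hO f l h⟩ with
    inf := fun O P => O ⊓ P
    inf_le_left := fun O P V f l h => h.1
    inf_le_right := fun O P V f l h => h.2
    le_inf := fun O P Q h h' V f l hl => ⟨h f l hl, h' f l hl⟩ }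

theorem res_comp {V W Z : C} (g : W ⟶ V) (k : Z ⟶ W) (l : X.Fin V) :
    X.res (k ≫ g) l = X.res k (X.res g l) := by
  simp [res]

theorem res_append {V W : C} (g : W ⟶ V) (l l' : X.Fin V) :
    X.res g (l ++ l') = X.res g l ++ X.res g l' := List.map_append

/-- The implication `O ⇒ P` of the frame of opens. -/
def imp (O P : X.Opens J U) : X.Opens J U where
  mem V f l := ∀ ⦃W : C⦄ (g : W ⟶ V) (k : X.Fin W), O.mem (g ≫ f) k → P.mem (g ≫ f) (X.res g l ++ k)
  mem_res V W f g l h Z k j hj := by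
    rw [← res_comp, ← Category.assoc]
    exact h (k ≫ g) j (by rwa [Category.assoc])
  mem_glue V f l S hS h W g k hk := by
    refine P.mem_glue (g ≫ f) _ (S.pullback g) (J.pullback_stable g hS) fun Z j hj => ?_
    have := h (j ≫ g) hj (𝟙 Z) (X.res j k) (by
      simpa using O.mem_res (g ≫ f) j k hk)
    rw [res_append, ← res_comp]
    rw [← res_comp] at this
    simpa using this
  mem_mono V f l l' hl h W g k hk := by
    refine P.mem_mono _ _ _ ?_ (h g k hk)
    intro x hx
    rcases List.mem_append.1 hx with hx | hx
    · exact List.mem_append_left _ (List.map_subset _ hl hx)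
    · exact List.mem_append_right _ hx
  mem_cover V f m n S hS h W g k hk := by
    rw [res_append, List.append_assoc]
    refine P.mem_cover (g ≫ f) _ _ _ (X.rel_res g m S hS) ?_
    rintro _ ⟨l, hl, rfl⟩
    have := h l hl g k hk
    rwa [res_append, List.append_assoc] at this

theorem res_id {V : C} (l : X.Fin V) : X.res (𝟙 V) l = l := by
  have h : (X.Gen.map (𝟙 V).op : X.Gen.obj (op V) → X.Gen.obj (op V)) = id := by
    ext x; simp
  rw [res, h, List.map_id]

theorem le_imp_iff (O P Q : X.Opens J U) : O ≤ imp P Q ↔ O ⊓ P ≤ Q := by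
  constructor
  · intro h V f l hl
    have h1 := h f l hl.1 (𝟙 V) l (by simpa using hl.2)
    rw [Category.id_comp, res_id] at h1
    exact Q.mem_mono f _ _ (List.append_subset.2 ⟨fun _ hx => hx, fun _ hx => hx⟩) h1
  · intro h V f l hl W g k hk
    exact h _ _ ⟨O.mem_mono _ _ _ (List.subset_append_left _ _) (O.mem_res f g l hl),
      P.mem_mono _ _ _ (List.subset_append_right _ _) hk⟩

instance : Order.Frame (X.Opens J U) :=
  Order.Frame.ofMinimalAxioms
    { inf_sSup_le_iSup_inf := fun O s => by
        rw [inf_comm, ← le_imp_iff]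
        refine sSup_le fun P hP => (le_imp_iff _ _ _).2 ?_
        rw [inf_comm]
        exact le_iSup₂_of_le P hP le_rfl }

/-- The open `⋀ l` given by finitely many generators. -/
def basic (J : GrothendieckTopology C) (l : X.Fin U) : X.Opens J U :=
  sInf {O | O.mem (𝟙 U) l}

theorem basic_le_iff (l : X.Fin U) (O : X.Opens J U) : basic J l ≤ O ↔ O.mem (𝟙 U) l :=
  ⟨fun h => h _ _ fun _ hP => hP, fun h => sInf_le h⟩

theorem basic_append (l l' : X.Fin U) : basic J (l ++ l') = basic J l ⊓ basic J l' := by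
  refine le_antisymm (le_inf ?_ ?_) ?_
  · exact (basic_le_iff _ _).2 ((basic J l).mem_mono _ _ _ (List.subset_append_left _ _)
      ((basic_le_iff _ _).1 le_rfl))
  · exact (basic_le_iff _ _).2 ((basic J l').mem_mono _ _ _ (List.subset_append_right _ _)
      ((basic_le_iff _ _).1 le_rfl))
  · rw [← le_imp_iff, basic_le_iff]
    suffices h : basic J l' ≤ imp (basic J l) (basic J (l ++ l')) by
      have h' := (le_imp_iff _ _ _).1 h
      rw [inf_comm, ← le_imp_iff, basic_le_iff] at h'
      exact h'
    rw [basic_le_iff]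
    intro W g k hk
    have h0 : basic J l ≤
        { mem := fun V f k => (basic J (l ++ l')).mem f (k ++ X.res f l')
          mem_res := fun V W f g k h => by
            have := (basic J (l ++ l')).mem_res f g _ h
            rwa [res_append, ← res_comp] at this
          mem_glue := fun V f k S hS h => by
            refine (basic J (l ++ l')).mem_glue f _ S hS fun W g hg => ?_
            have := h g hg
            rwa [res_comp, ← res_append] at this
          mem_mono := fun V f k k' hk h => by
            refine (basic J (l ++ l')).mem_mono f _ _ ?_ h
            exact List.append_subset.2 ⟨fun x hx => List.mem_append_left _ (hk hx),
              List.subset_append_right _ _⟩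
          mem_cover := fun V f m n S hS h => by
            rw [List.append_assoc]
            refine (basic J (l ++ l')).mem_cover f m _ S hS fun j hj => ?_
            rw [← List.append_assoc]
            exact h j hj } := by
      rw [basic_le_iff]
      change (basic J (l ++ l')).mem (𝟙 U) (l ++ X.res (𝟙 U) l')
      rw [res_id]
      exact (basic_le_iff _ _).1 le_rfl
    have h1 := h0 _ _ hk
    change (basic J (l ++ l')).mem (g ≫ 𝟙 U) (k ++ X.res (g ≫ 𝟙 U) l') at h1
    refine (basic J (l ++ l')).mem_mono _ _ _ ?_ h1
    rw [Category.comp_id]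
    exact List.append_subset.2 ⟨List.subset_append_right _ _, List.subset_append_left _ _⟩

/-- The relations hold in the frame of opens. -/
theorem basic_le_of_rel {m : X.Fin U} {S : Set (X.Fin U)} (h : X.Rel U m S) :
    basic J m ≤ ⨆ l ∈ S, basic J l := by
  rw [basic_le_iff]
  have := (⨆ l ∈ S, basic J l).mem_cover (𝟙 U) m [] S h fun l hl => by
    rw [List.append_nil, ← basic_le_iff]
    exact le_iSup₂_of_le l hl le_rfl
  rwa [List.append_nil] at this

theorem basic_nil : basic J ([] : X.Fin U) = ⊤ := by
  refine top_unique fun V f l _ P hP => ?_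
  have h : P.mem (f ≫ 𝟙 U) (X.res f []) := P.mem_res (𝟙 U) f [] hP
  rw [Category.comp_id] at h
  exact P.mem_mono f [] l (List.nil_subset _) h

/-- The truth value of `O = ⊤`. -/
def eqTop (O : X.Opens J U) : Sieve U where
  arrows V f := O.mem f []
  downward_closed h g := O.mem_res _ g [] h

end Opens

end Presentation

/-! ### Maps of locales into `ℂ` and their norm -/

/-- A map of locales `X → ℂ` at stage `U`, where `X` is a presented locale: since the locale `ℂ` is
presented by the rational open rectangles and the relations `Rect.Rel`, such a map is given by its
inverse image on rectangles, which has to respect these relations.  The rectangles form a constant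
sheaf, so the inverse images at stage `U` determine, by restriction, those at later stages. -/
structure MapToC (J : GrothendieckTopology C) (X : Presentation.{w} C) (U : C) where
  inv : Rect → X.Opens J U
  inv_total : ⨆ R, inv R = ⊤
  inv_inter : ∀ R R' : Rect, inv R ⊓ inv R' ≤ inv (R.inter R')
  inv_cover : ∀ (R : Rect) (L : List Rect), (∀ z ∈ R.pts, ∃ P ∈ L, z ∈ P.pts) →
    inv R ≤ ⨆ P ∈ L, inv P
  inv_inner : ∀ R : Rect, inv R ≤ ⨆ R' : {R' : Rect // R'.WellInside R}, inv R'.1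

namespace MapToC

variable {J : GrothendieckTopology C} {X : Presentation.{w} C} {U : C}

/-- The inverse image of the open disc of radius `q` around `0`, which is the union of the
rectangles that it contains. -/
def invDisc (h : MapToC J X U) (q : PosRat) : X.Opens J U :=
  ⨆ R : {R : Rect // ∀ z ∈ R.pts, z.re ^ 2 + z.im ^ 2 < q.1 ^ 2}, h.inv R.1

/-- The norm of a map of locales `h : X → ℂ`, as a set of positive rationals: `‖h‖ < q` if and only
if the inverse image of the open disc of radius `q` is the whole of `X`. -/
def normLT (h : MapToC J X U) (q : PosRat) : Sieve U := (h.invDisc q).eqTop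

end MapToC

/-! ### The Gelfand transform -/

namespace CommCStarAlgebra

variable {J : GrothendieckTopology C} (A : CommCStarAlgebra.{w} J)

/-- The relations of the locale of multiplicative functionals on `A`, at stage `U`.  The generator
`(a, R)` is the open `a ∈ R`, intuitively `{φ | φ a ∈ R}`.  The relations say that every `a` gives a
map to `ℂ`, and that these maps together form a unital `*`-homomorphism over `ℚ[i]`. -/
inductive MFnRel (U : C) : List (A.El U × Rect) → Set (List (A.El U × Rect)) → Prop
  | complex (a : A.El U) (m : List (A.El U × Rect)) (S : Set (List (A.El U × Rect))) :
      Rect.Rel (fun R => (a, R)) m S → MFnRel U m S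
  | scalar (z : CRat) (R : Rect) : z ∈ R.pts → MFnRel U [] {[(algebraMap CRat (A.El U) z, R)]}
  | add (a b : A.El U) (R R' P : Rect) : (∀ z ∈ R.pts, ∀ z' ∈ R'.pts, z + z' ∈ P.pts) →
      MFnRel U [(a, R), (b, R')] {[(a + b, P)]}
  | mul (a b : A.El U) (R R' P : Rect) : (∀ z ∈ R.pts, ∀ z' ∈ R'.pts, z * z' ∈ P.pts) →
      MFnRel U [(a, R), (b, R')] {[(a * b, P)]}
  | star (a : A.El U) (R P : Rect) : (∀ z ∈ R.pts, star z ∈ P.pts) →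
      MFnRel U [(a, R)] {[(star a, P)]}

theorem MFnRel.map {U V : C} (f : V ⟶ U) {m : List (A.El U × Rect)}
    {S : Set (List (A.El U × Rect))} (h : A.MFnRel U m S) :
    A.MFnRel V (m.map fun x => (A.res f x.1, x.2))
      (List.map (fun x => (A.res f x.1, x.2)) '' S) := by
  cases h with
  | complex a _ _ h =>
    exact MFnRel.complex (A.res f a) _ _
      (h.map (fun x : A.El U × Rect => ((A.res f x.1, x.2) : A.El V × Rect)))
  | scalar z R hz =>
    have h := MFnRel.scalar (A := A) (U := V) z R hz
    rw [Set.image_singleton, List.map_singleton, AlgHom.commutes]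
    exact h
  | add a b R R' P hP =>
    have h := MFnRel.add (A := A) (A.res f a) (A.res f b) R R' P hP
    rw [Set.image_singleton, List.map_singleton, map_add]
    exact h
  | mul a b R R' P hP =>
    have h := MFnRel.mul (A := A) (A.res f a) (A.res f b) R R' P hP
    rw [Set.image_singleton, List.map_singleton, map_mul]
    exact h
  | star a R P hP =>
    have h := MFnRel.star (A := A) (A.res f a) R P hP
    rw [← A.star_res] at h
    rw [Set.image_singleton]
    exact h

/-- The locale `MFn(A)` of multiplicative functionals on `A`. -/
def MFn : Presentation.{w} C where
  Gen :=
    { obj := fun U => A.alg.obj U × Rect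
      map := fun f => TypeCat.ofHom fun x => ((A.alg.map f).hom x.1, x.2)
      map_id := fun U => by ext x <;> simp
      map_comp := fun f g => by ext x <;> simp }
  Rel := A.MFnRel
  rel_res := fun f _ _ h => MFnRel.map A f h

/-- The open `a ∈ R` of `MFn(A)`. -/
def opn {U : C} (a : A.El U) (R : Rect) : A.MFn.Opens J U :=
  Presentation.Opens.basic J (X := A.MFn) [(a, R)]

/-- The Gelfand transform of `b`: the map of locales `MFn(A) → ℂ` for which the inverse image of a
rectangle `R` is the open `b ∈ R`. -/
def gelfand {U : C} (b : A.El U) : MapToC J A.MFn U where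
  inv R := A.opn b R
  inv_total := by
    refine top_unique ?_
    rw [← Presentation.Opens.basic_nil (X := A.MFn)]
    refine (Presentation.Opens.basic_le_of_rel (X := A.MFn)
      (MFnRel.complex b _ _ Rect.Rel.total)).trans (iSup₂_le ?_)
    rintro _ ⟨R, rfl⟩
    exact le_iSup (fun R => A.opn b R) R
  inv_inter R R' := by
    have h := Presentation.Opens.basic_le_of_rel (J := J) (X := A.MFn)
      (MFnRel.complex b _ _ (Rect.Rel.inter R R'))
    refine le_trans (Presentation.Opens.basic_append (X := A.MFn) [(b, R)] [(b, R')]).ge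
      (h.trans (iSup₂_le ?_))
    rintro _ rfl
    exact le_rfl
  inv_cover R L hL := by
    refine (Presentation.Opens.basic_le_of_rel (X := A.MFn)
      (MFnRel.complex b _ _ (Rect.Rel.cover R L hL))).trans (iSup₂_le ?_)
    rintro _ ⟨P, hP, rfl⟩
    exact le_iSup₂ (f := fun P (_ : P ∈ L) => A.opn b P) P hP
  inv_inner R := by
    refine (Presentation.Opens.basic_le_of_rel (X := A.MFn)
      (MFnRel.complex b _ _ (Rect.Rel.inner R))).trans (iSup₂_le ?_)
    rintro _ ⟨P, hP, rfl⟩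
    exact le_iSup (fun R' : {R' : Rect // R'.WellInside R} => A.opn b R'.1) ⟨P, hP⟩

end CommCStarAlgebra

end ToposGelfand

/-!
# The Gelfand transform is norm-preserving

The metatheory is classical, so at each stage `U` ordinary Gelfand duality is available. The
elements of `A` at `U` that are bounded by one rational number on all of `U` form a ring
`bounded A U`, and the infimum of the rational bounds is a real valued C⋆-seminorm on it, over the
complex rationals. Its completion is a commutative C⋆-algebra in the usual sense, so that
`bounded A U` maps isometrically onto a dense subring of some `C(X, ℂ)`, with `X` compact
(`exists_isometric_denseRange_continuousMap`). Two facts follow. There are enough characters of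
`bounded A U` to compute the norm (`normLT_of_forall_character`). And, as completeness of `A` in the
topos makes `bounded A U` complete, its image is all of `C(X, ℂ)`, whence `q² - a a*` has a
selfadjoint square root if `‖a‖ < q` (`exists_selfAdjoint_sq`).

*If `‖b̂‖ < q`, then `‖b‖ < q`* (`normLT_gelfand_le`). A finite meet of generators is declared to be
controlled if, for each choice of rectangles well inside those that it names, locally every
character `φ` that obeys these smaller constraints satisfies `|φ b| < q` (`ControlOn`). The controlled
meets form an open of `MFn(A)`: the relations hold at the level of characters, and the passage to
smaller rectangles, which confines everything to compact subsets of `ℂ`, makes finitely many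
constraints suffice on the right hand side of each relation. That open contains the inverse image of
the disc of radius `q`. So if this inverse image is everything, then locally `|φ b| < q` for all
characters, and `‖b‖ < q`.

*If `‖b‖ < q`, then `‖b̂‖ < q`* (`le_normLT_gelfand`). Locally `‖b‖ < r < q`, and there is a
selfadjoint `y` with `y² + b b* = r²`. Inside `MFn(A)`, the values of `b` and `y` are located in
small rectangles. If the one for `b` is not in the disc of radius `q`, then `b b*` lies to the right
of `r²`, while `y²` has nearly non negative real part since `y` is selfadjoint; this contradicts the
relations for sums and scalars (`mem_of_far`). So only the rectangles in the disc remain.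
-/

namespace ToposGelfand

/-! ### Gelfand duality over the complex rationals -/

/-- The inclusion of the complex rationals into the complex numbers. -/
def CRat.toComplex : CRat →+* ℂ where
  toFun z := ⟨z.re, z.im⟩
  map_one' := Complex.ext (by change ((1 : ℚ) : ℝ) = 1; simp) (by change ((0 : ℚ) : ℝ) = 0; simp)
  map_zero' := by apply Complex.ext <;> simp
  map_add' x y := by apply Complex.ext <;> simp
  map_mul' x y := by
    apply Complex.ext
    · simp; ring
    · simp

@[simp] theorem CRat.toComplex_re (z : CRat) : (CRat.toComplex z).re = z.re := rfl
@[simp] theorem CRat.toComplex_im (z : CRat) : (CRat.toComplex z).im = z.im := rfl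

theorem CRat.toComplex_star (z : CRat) : CRat.toComplex (star z) = star (CRat.toComplex z) := by
  apply Complex.ext <;> simp

theorem CRat.denseRange_toComplex : DenseRange CRat.toComplex := by
  have h : DenseRange (Prod.map ((↑) : ℚ → ℝ) ((↑) : ℚ → ℝ)) :=
    Rat.denseRange_cast.prodMap Rat.denseRange_cast
  have h2 : DenseRange (Complex.equivRealProdCLM.symm ∘ Prod.map ((↑) : ℚ → ℝ) ((↑) : ℚ → ℝ)) :=
    Complex.equivRealProdCLM.symm.surjective.denseRange.comp h
      Complex.equivRealProdCLM.symm.continuous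
  refine h2.mono ?_
  rintro _ ⟨⟨x, y⟩, rfl⟩
  exact ⟨⟨x, y⟩, by apply Complex.ext <;> simp⟩

open UniformSpace in
/-- Gelfand duality for a commutative C⋆-seminormed ring over the complex rationals: it maps
isometrically onto a dense subring of the continuous functions on a compact space, namely the
Gelfand spectrum of its completion. -/
theorem exists_isometric_denseRange_continuousMap (E : Type w) [SeminormedCommRing E] [StarRing E]
    (hstar : ∀ x : E, ‖star x‖ = ‖x‖) (hC : ∀ x : E, ‖x * star x‖ = ‖x‖ * ‖x‖)
    (j : CRat →+* E) (hj : ∀ z, ‖j z‖ ≤ ‖CRat.toComplex z‖) (hjs : ∀ z, star (j z) = j (star z)) :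
    ∃ (X : Type w) (_ : TopologicalSpace X) (_ : CompactSpace X) (Γ : E →+* C(X, ℂ)),
      (∀ x, ‖Γ x‖ = ‖x‖) ∧ (∀ x, Γ (star x) = star (Γ x)) ∧
      (∀ z, Γ (j z) = algebraMap ℂ _ (CRat.toComplex z)) ∧ DenseRange Γ := by
  -- the action of `ℂ` on the completion, extended from that of the complex rationals
  let _ : PseudoMetricSpace CRat := PseudoMetricSpace.induced CRat.toComplex inferInstance
  have ui : IsUniformInducing CRat.toComplex := ⟨rfl⟩
  let f : CRat →+* Completion E := Completion.coeRingHom.comp j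
  have hf0 : ∀ z, f z = ((j z : E) : Completion E) := fun z => rfl
  have hf : UniformContinuous f := by
    refine (LipschitzWith.of_dist_le_mul (K := 1) fun x y => ?_).uniformContinuous
    rw [dist_eq_norm, ← map_sub, hf0, Completion.norm_coe, NNReal.coe_one, one_mul]
    refine (hj _).trans ?_
    rw [map_sub, ← dist_eq_norm]
    exact le_rfl
  let ι : ℂ →+* Completion E := IsDenseInducing.extendRingHom ui CRat.denseRange_toComplex hf
  have hι : Continuous ι :=
    (uniformContinuous_uniformly_extend ui CRat.denseRange_toComplex hf).continuous
  have hιj : ∀ z, ι (CRat.toComplex z) = ((j z : E) : Completion E) := fun z =>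
    IsDenseInducing.extend_eq (ui.isDenseInducing CRat.denseRange_toComplex) hf.continuous z
  have hιn : ∀ z, ‖ι z‖ ≤ ‖z‖ := fun z => by
    refine CRat.denseRange_toComplex.induction_on z
      (isClosed_le (by fun_prop) (by fun_prop)) fun r => ?_
    rw [hιj, Completion.norm_coe]
    exact hj r
  let _ : Algebra ℂ (Completion E) := ι.toAlgebra
  let _ : NormedAlgebra ℂ (Completion E) :=
    { norm_smul_le := fun z x => by
        rw [Algebra.smul_def]
        exact (norm_mul_le _ _).trans (by gcongr; exact hιn z) }
  -- the involution of the completion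
  have hsu : UniformContinuous (star : E → E) := by
    refine (AddMonoidHomClass.isometry_of_norm (starAddEquiv : E ≃+ E) hstar).uniformContinuous
  have hsc : Continuous (Completion.map (star : E → E)) := Completion.continuous_map
  have hs0 : ∀ x : E, Completion.map (star : E → E) x = ((star x : E) : Completion E) :=
    fun x => Completion.map_coe hsu x
  let _ : StarRing (Completion E) :=
    { star := Completion.map star
      star_involutive := fun x => by
        refine Completion.induction_on x
          (isClosed_eq (hsc.comp hsc) continuous_id) fun a => ?_
        rw [hs0, hs0, star_star]
      star_mul := fun x y => by
        refine Completion.induction_on₂ x y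
          (isClosed_eq (by fun_prop) (by fun_prop)) fun a b => ?_
        rw [hs0, hs0, ← Completion.coe_mul, hs0, star_mul, Completion.coe_mul]
      star_add := fun x y => by
        refine Completion.induction_on₂ x y
          (isClosed_eq (by fun_prop) (by fun_prop)) fun a b => ?_
        rw [hs0, hs0, ← Completion.coe_add, hs0, star_add, Completion.coe_add] }
  have hsc' : Continuous (star : Completion E → Completion E) := hsc
  have hs : ∀ x : E, star (x : Completion E) = ((star x : E) : Completion E) := hs0
  have : CStarRing (Completion E) :=
    ⟨fun x => by
      refine Completion.induction_on x (isClosed_le (by fun_prop) (by fun_prop)) fun a => ?_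
      rw [hs, ← Completion.coe_mul, Completion.norm_coe, Completion.norm_coe, mul_comm (star a),
        hC]⟩
  have hιs : ∀ z, star (ι z) = ι (star z) := fun z => by
    refine CRat.denseRange_toComplex.induction_on z
      (isClosed_eq (by fun_prop) (by fun_prop)) fun r => ?_
    rw [← CRat.toComplex_star, hιj, hιj, hs, hjs]
  have _ : StarModule ℂ (Completion E) :=
    ⟨fun z x => by
      rw [Algebra.smul_def, Algebra.smul_def, star_mul']
      exact congrArg (fun y => y * star x) (hιs z)⟩
  let _ : _root_.CommCStarAlgebra (Completion E) := { }
  refine ⟨WeakDual.characterSpace ℂ (Completion E), inferInstance, inferInstance,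
    (WeakDual.gelfandTransform ℂ (Completion E) : Completion E →+* _).comp Completion.coeRingHom,
    fun x => ?_, fun x => ?_, fun z => ?_, ?_⟩
  · have := (AddMonoidHomClass.isometry_iff_norm _).1 (gelfandTransform_isometry (Completion E)) x
    exact this.trans (Completion.norm_coe x)
  · have := gelfandTransform_map_star (x : Completion E)
    rw [hs] at this
    exact this
  · have := AlgHomClass.commutes (WeakDual.gelfandTransform ℂ (Completion E)) (CRat.toComplex z)
    rw [← this]
    exact congrArg (WeakDual.gelfandTransform ℂ (Completion E)) (hιj z).symm
  · exact ((gelfandTransform_bijective (Completion E)).2.denseRange).comp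
      Completion.denseRange_coe (gelfandTransform_isometry (Completion E)).continuous

/-! ### Rational rectangles in the complex plane -/

namespace Rect

/-- The complex numbers that lie in a rational open rectangle. -/
def cpts (R : Rect) : Set ℂ :=
  {z | R.lo.re < z.re ∧ z.re < R.hi.re ∧ R.lo.im < z.im ∧ z.im < R.hi.im}

/-- The closed rectangle with the corners of `R`. -/
def box (R : Rect) : Set ℂ :=
  {z | R.lo.re ≤ z.re ∧ z.re ≤ R.hi.re ∧ R.lo.im ≤ z.im ∧ z.im ≤ R.hi.im}

theorem toComplex_mem_cpts {R : Rect} {z : CRat} : CRat.toComplex z ∈ R.cpts ↔ z ∈ R.pts := by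
  simp [cpts, pts]

theorem cpts_subset_box (R : Rect) : R.cpts ⊆ R.box :=
  fun _ h => ⟨h.1.le, h.2.1.le, h.2.2.1.le, h.2.2.2.le⟩

theorem isOpen_cpts (R : Rect) : IsOpen R.cpts :=
  (isOpen_lt continuous_const Complex.continuous_re).inter
    ((isOpen_lt Complex.continuous_re continuous_const).inter
      ((isOpen_lt continuous_const Complex.continuous_im).inter
        (isOpen_lt Complex.continuous_im continuous_const)))

theorem box_eq_reProdIm (R : Rect) :
    R.box = Set.Icc (R.lo.re : ℝ) R.hi.re ×ℂ Set.Icc (R.lo.im : ℝ) R.hi.im := by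
  ext z
  simp only [box, Set.mem_ofPred_eq, Complex.mem_reProdIm, Set.mem_Icc, and_assoc]

theorem isCompact_box (R : Rect) : IsCompact R.box := by
  rw [box_eq_reProdIm]
  exact isCompact_Icc.reProdIm isCompact_Icc

theorem WellInside.box_subset {R' R : Rect} (h : R'.WellInside R) : R'.box ⊆ R.cpts := by
  obtain ⟨h1, h2, h3, h4⟩ := h
  rintro z ⟨k1, k2, k3, k4⟩
  exact ⟨(Rat.cast_lt.2 h1).trans_le k1, k2.trans_lt (Rat.cast_lt.2 h2),
    (Rat.cast_lt.2 h3).trans_le k3, k4.trans_lt (Rat.cast_lt.2 h4)⟩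

theorem WellInside.exists_between {R' R : Rect} (h : R'.WellInside R) :
    ∃ R'' : Rect, R'.WellInside R'' ∧ R''.WellInside R := by
  obtain ⟨h1, h2, h3, h4⟩ := h
  obtain ⟨a, a1, a2⟩ := _root_.exists_between h1
  obtain ⟨b, b1, b2⟩ := _root_.exists_between h2
  obtain ⟨c, c1, c2⟩ := _root_.exists_between h3
  obtain ⟨d, d1, d2⟩ := _root_.exists_between h4
  exact ⟨⟨⟨a, c⟩, ⟨b, d⟩⟩, ⟨a2, b1, c2, d1⟩, ⟨a1, b2, c1, d2⟩⟩

theorem WellInside.inter {R' R S' S : Rect} (h : R'.WellInside R) (k : S'.WellInside S) :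
    (R'.inter S').WellInside (R.inter S) :=
  ⟨max_lt_max h.1 k.1, min_lt_min h.2.1 k.2.1, max_lt_max h.2.2.1 k.2.2.1,
    min_lt_min h.2.2.2 k.2.2.2⟩

theorem mem_cpts_inter {R S : Rect} {z : ℂ} : z ∈ (R.inter S).cpts ↔ z ∈ R.cpts ∧ z ∈ S.cpts := by
  simp only [cpts, Rect.inter, Set.mem_ofPred_eq, Rat.cast_max, Rat.cast_min, max_lt_iff, lt_min_iff]
  tauto

/-- The rectangle `R` with all sides moved inwards by `1 / (n + 1)`. -/
def shrink (n : ℕ) (R : Rect) : Rect :=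
  ⟨⟨R.lo.re + 1 / (n + 1), R.lo.im + 1 / (n + 1)⟩, ⟨R.hi.re - 1 / (n + 1), R.hi.im - 1 / (n + 1)⟩⟩

theorem shrink_wellInside (n : ℕ) (R : Rect) : (shrink n R).WellInside R := by
  have h : (0 : ℚ) < 1 / (n + 1) := Nat.one_div_pos_of_nat
  refine ⟨?_, ?_, ?_, ?_⟩ <;> simp only [shrink] <;> linarith

theorem shrink_cpts_mono (R : Rect) : Monotone fun n => (shrink n R).cpts := by
  intro m n hmn z hz
  have h : (1 : ℝ) / (n + 1) ≤ 1 / (m + 1) := Nat.one_div_le_one_div hmn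
  simp only [shrink, cpts, Set.mem_ofPred_eq] at hz ⊢
  push_cast at hz ⊢
  obtain ⟨h1, h2, h3, h4⟩ := hz
  refine ⟨?_, ?_, ?_, ?_⟩ <;> linarith

theorem exists_mem_shrink {R : Rect} {z : ℂ} (hz : z ∈ R.cpts) : ∃ n, z ∈ (shrink n R).cpts := by
  obtain ⟨h1, h2, h3, h4⟩ := hz
  obtain ⟨n, hn⟩ := exists_nat_one_div_lt (K := ℝ)
    (lt_min (lt_min (sub_pos.2 h1) (sub_pos.2 h2)) (lt_min (sub_pos.2 h3) (sub_pos.2 h4)))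
  simp only [lt_min_iff] at hn
  refine ⟨n, ?_⟩
  simp only [shrink, cpts, Set.mem_ofPred_eq]
  push_cast
  refine ⟨?_, ?_, ?_, ?_⟩ <;> linarith

/-- A compact set covered by finitely many open rectangles is covered by rectangles well inside
these. -/
theorem exists_wellInside_cover {K : Set ℂ} (hK : IsCompact K) (L : List Rect)
    (hL : ∀ z ∈ K, ∃ P ∈ L, z ∈ P.cpts) :
    ∃ σ : Rect → Rect, (∀ P, (σ P).WellInside P) ∧ ∀ z ∈ K, ∃ P ∈ L, z ∈ (σ P).cpts := by
  obtain ⟨n, hn⟩ := hK.elim_directed_cover (fun n => ⋃ P ∈ L, (shrink n P).cpts)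
    (fun n => isOpen_biUnion fun P _ => isOpen_cpts _)
    (fun z hz => by
      obtain ⟨P, hP, h⟩ := hL z hz
      obtain ⟨n, hn⟩ := exists_mem_shrink h
      exact Set.mem_iUnion.2 ⟨n, Set.mem_biUnion hP hn⟩)
    (Monotone.directed_le fun m n h => Set.iUnion₂_mono fun P _ => shrink_cpts_mono P h)
  refine ⟨shrink n, shrink_wellInside n, fun z hz => ?_⟩
  simpa using hn hz

theorem exists_wellInside_subset {K : Set ℂ} (hK : IsCompact K) {P : Rect} (hP : K ⊆ P.cpts) :
    ∃ P' : Rect, P'.WellInside P ∧ K ⊆ P'.cpts := by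
  obtain ⟨σ, h1, h2⟩ := exists_wellInside_cover hK [P] fun z hz => ⟨P, by simp, hP hz⟩
  exact ⟨σ P, h1 P, fun z hz => by simpa using h2 z hz⟩

/-- A real number can be replaced by a rational one without changing its position relative to
finitely many given rationals. -/
theorem exists_rat_same_position (x : ℝ) (F : List ℚ) :
    ∃ r : ℚ, ∀ c ∈ F, ((c : ℝ) < x ↔ c < r) ∧ (x < c ↔ r < c) := by
  by_cases hx : ∃ r : ℚ, (r : ℝ) = x
  · obtain ⟨r, rfl⟩ := hx
    exact ⟨r, fun c _ => ⟨Rat.cast_lt, Rat.cast_lt⟩⟩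
  · have key : ∀ᶠ y : ℝ in nhds x, ∀ c ∈ F.toFinset,
        ((c : ℝ) < x ↔ (c : ℝ) < y) ∧ (x < c ↔ y < c) := by
      refine (Filter.eventually_all_finset _).2 fun c _ => ?_
      rcases lt_trichotomy (c : ℝ) x with h | h | h
      · filter_upwards [lt_mem_nhds h] with y hy
        simp [h, hy, h.not_gt, hy.not_gt]
      · exact (hx ⟨c, h⟩).elim
      · filter_upwards [gt_mem_nhds h] with y hy
        simp [h, hy, h.not_gt, hy.not_gt]
    obtain ⟨r, hr⟩ := (Rat.denseRange_cast (𝕜 := ℝ)).exists_mem_open isOpen_interior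
      ⟨x, mem_interior_iff_mem_nhds.2 key⟩
    have := interior_subset hr
    refine ⟨r, fun c hc => ?_⟩
    simpa using this c (by simpa using hc)

theorem cpts_cover {R : Rect} {L : List Rect} (h : ∀ z ∈ R.pts, ∃ P ∈ L, z ∈ P.pts) :
    ∀ z ∈ R.cpts, ∃ P ∈ L, z ∈ P.cpts := by
  intro z hz
  obtain ⟨x, hx⟩ := exists_rat_same_position z.re
    ((R :: L).map (fun P => P.lo.re) ++ (R :: L).map fun P => P.hi.re)
  obtain ⟨y, hy⟩ := exists_rat_same_position z.im
    ((R :: L).map (fun P => P.lo.im) ++ (R :: L).map fun P => P.hi.im)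
  have key : ∀ P ∈ R :: L, z ∈ P.cpts ↔ (⟨x, y⟩ : CRat) ∈ P.pts := fun P hP => by
    have m1 := (hx P.lo.re (List.mem_append_left _ (List.mem_map_of_mem hP))).1
    have m2 := (hx P.hi.re (List.mem_append_right _ (List.mem_map_of_mem hP))).2
    have m3 := (hy P.lo.im (List.mem_append_left _ (List.mem_map_of_mem hP))).1
    have m4 := (hy P.hi.im (List.mem_append_right _ (List.mem_map_of_mem hP))).2
    simp only [cpts, pts, Set.mem_ofPred_eq, m1, m2, m3, m4]
  obtain ⟨P, hP, hzP⟩ := h _ ((key R (by simp)).1 hz)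
  exact ⟨P, hP, (key P (by simp [hP])).2 hzP⟩

/-- The four corners of a rectangle, indexed by pairs of Booleans. -/
def corner (R : Rect) (s t : Bool) : CRat :=
  ⟨if s then R.hi.re else R.lo.re, if t then R.hi.im else R.lo.im⟩

theorem WellInside.corner_mem {R' R : Rect} (h : R'.WellInside R) {z : ℂ} (hz : z ∈ R'.box)
    (s t : Bool) : R'.corner s t ∈ R.pts := by
  obtain ⟨h1, h2, h3, h4⟩ := h
  have a : R'.lo.re ≤ R'.hi.re := Rat.cast_le (K := ℝ) |>.1 (hz.1.trans hz.2.1)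
  have b : R'.lo.im ≤ R'.hi.im := Rat.cast_le (K := ℝ) |>.1 (hz.2.2.1.trans hz.2.2.2)
  cases s <;> cases t <;> simp only [corner, pts, Set.mem_ofPred_eq] <;>
    refine ⟨?_, ?_, ?_, ?_⟩ <;> simp <;> linarith

/-- An affine function that is less than `c` at both ends of an interval is so on the interval. -/
theorem affine_lt {a b x α β c : ℝ} (ha : a ≤ x) (hb : x ≤ b) (h1 : α * a + β < c)
    (h2 : α * b + β < c) : α * x + β < c := by
  rcases le_total 0 α with h | h <;> nlinarith

/-- A function of two complex variables that is affine in each of the four real coordinates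
satisfies a strict upper bound on a product of closed rectangles if it does so at the corners. -/
theorem lt_of_corners {F : ℝ → ℝ → ℝ → ℝ → ℝ} {c : ℝ}
    (h1 : ∀ y x' y', ∃ α β, ∀ x, F x y x' y' = α * x + β)
    (h2 : ∀ x x' y', ∃ α β, ∀ y, F x y x' y' = α * y + β)
    (h3 : ∀ x y y', ∃ α β, ∀ x', F x y x' y' = α * x' + β)
    (h4 : ∀ x y x', ∃ α β, ∀ y', F x y x' y' = α * y' + β) {R S : Rect}
    (h : ∀ s t s' t', F (R.corner s t).re (R.corner s t).im (S.corner s' t').re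
      (S.corner s' t').im < c) {z z' : ℂ} (hz : z ∈ R.box) (hz' : z' ∈ S.box) :
    F z.re z.im z'.re z'.im < c := by
  have step : ∀ {f : ℝ → ℝ} (hf : ∃ α β, ∀ x, f x = α * x + β) {a b x : ℝ}, a ≤ x → x ≤ b →
      f a < c → f b < c → f x < c := by
    rintro f ⟨α, β, hf⟩ a b x ha hb h1 h2
    rw [hf] at h1 h2 ⊢
    exact affine_lt ha hb h1 h2
  have e1 : ∀ t s' t', F z.re (R.corner true t).im (S.corner s' t').re (S.corner s' t').im < c :=
    fun t s' t' => step (h1 _ _ _) hz.1 hz.2.1 (h false t s' t') (h true t s' t')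
  have e2 : ∀ s' t', F z.re z.im (S.corner s' t').re (S.corner s' t').im < c :=
    fun s' t' => step (h2 _ _ _) hz.2.2.1 hz.2.2.2 (e1 false s' t') (e1 true s' t')
  have e3 : ∀ t', F z.re z.im z'.re (S.corner true t').im < c :=
    fun t' => step (h3 _ _ _) hz'.1 hz'.2.1 (e2 false t') (e2 true t')
  exact step (h4 _ _ _) hz'.2.2.1 hz'.2.2.2 (e3 false) (e3 true)

theorem mul_mem_cpts {R' R S' S P : Rect} (hR : R'.WellInside R) (hS : S'.WellInside S)
    (h : ∀ z ∈ R.pts, ∀ z' ∈ S.pts, z * z' ∈ P.pts) {z z' : ℂ} (hz : z ∈ R'.box)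
    (hz' : z' ∈ S'.box) : z * z' ∈ P.cpts := by
  have key : ∀ s t s' t', CRat.toComplex (R'.corner s t) * CRat.toComplex (S'.corner s' t') ∈
      P.cpts := fun s t s' t' => by
    rw [← map_mul, toComplex_mem_cpts]
    exact h _ (hR.corner_mem hz s t) _ (hS.corner_mem hz' s' t')
  refine ⟨?_, ?_, ?_, ?_⟩
  · rw [← neg_lt_neg_iff]
    refine lt_of_corners (F := fun x y x' y' => -(x * x' - y * y')) (R := R') (S := S')
      ?_ ?_ ?_ ?_ (fun s t s' t' => neg_lt_neg (key s t s' t').1) hz hz'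
    · exact fun y x' y' => ⟨-x', y * y', fun x => by ring⟩
    · exact fun x x' y' => ⟨y', -(x * x'), fun y => by ring⟩
    · exact fun x y y' => ⟨-x, y * y', fun x' => by ring⟩
    · exact fun x y x' => ⟨y, -(x * x'), fun y' => by ring⟩
  · refine lt_of_corners (F := fun x y x' y' => x * x' - y * y') (R := R') (S := S')
      ?_ ?_ ?_ ?_ (fun s t s' t' => (key s t s' t').2.1) hz hz'
    · exact fun y x' y' => ⟨x', -(y * y'), fun x => by ring⟩
    · exact fun x x' y' => ⟨-y', x * x', fun y => by ring⟩
    · exact fun x y y' => ⟨x, -(y * y'), fun x' => by ring⟩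
    · exact fun x y x' => ⟨-y, x * x', fun y' => by ring⟩
  · rw [← neg_lt_neg_iff]
    refine lt_of_corners (F := fun x y x' y' => -(x * y' + y * x')) (R := R') (S := S')
      ?_ ?_ ?_ ?_ (fun s t s' t' => neg_lt_neg (key s t s' t').2.2.1) hz hz'
    · exact fun y x' y' => ⟨-y', -(y * x'), fun x => by ring⟩
    · exact fun x x' y' => ⟨-x', -(x * y'), fun y => by ring⟩
    · exact fun x y y' => ⟨-y, -(x * y'), fun x' => by ring⟩
    · exact fun x y x' => ⟨-x, -(y * x'), fun y' => by ring⟩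
  · refine lt_of_corners (F := fun x y x' y' => x * y' + y * x') (R := R') (S := S')
      ?_ ?_ ?_ ?_ (fun s t s' t' => (key s t s' t').2.2.2) hz hz'
    · exact fun y x' y' => ⟨y', y * x', fun x => by ring⟩
    · exact fun x x' y' => ⟨x', x * y', fun y => by ring⟩
    · exact fun x y y' => ⟨y, x * y', fun x' => by ring⟩
    · exact fun x y x' => ⟨x, y * x', fun y' => by ring⟩

theorem add_mem_cpts {R' R S' S P : Rect} (hR : R'.WellInside R) (hS : S'.WellInside S)
    (h : ∀ z ∈ R.pts, ∀ z' ∈ S.pts, z + z' ∈ P.pts) {z z' : ℂ} (hz : z ∈ R'.box)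
    (hz' : z' ∈ S'.box) : z + z' ∈ P.cpts := by
  have key : ∀ s, CRat.toComplex (R'.corner s s) + CRat.toComplex (S'.corner s s) ∈
      P.cpts := fun s => by
    rw [← map_add, toComplex_mem_cpts]
    exact h _ (hR.corner_mem hz s s) _ (hS.corner_mem hz' s s)
  obtain ⟨l1, -, l3, -⟩ := key false
  obtain ⟨-, u2, -, u4⟩ := key true
  exact ⟨l1.trans_le (add_le_add hz.1 hz'.1), (add_le_add hz.2.1 hz'.2.1).trans_lt u2,
    l3.trans_le (add_le_add hz.2.2.1 hz'.2.2.1), (add_le_add hz.2.2.2 hz'.2.2.2).trans_lt u4⟩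

theorem star_mem_cpts {R' R P : Rect} (hR : R'.WellInside R)
    (h : ∀ z ∈ R.pts, star z ∈ P.pts) {z : ℂ} (hz : z ∈ R'.box) : star z ∈ P.cpts := by
  have key : ∀ s t, star (CRat.toComplex (R'.corner s t)) ∈ P.cpts := fun s t => by
    rw [← CRat.toComplex_star, toComplex_mem_cpts]
    exact h _ (hR.corner_mem hz s t)
  obtain ⟨l1, -, -, l4⟩ := key false false
  obtain ⟨-, u2, u3, -⟩ := key true true
  exact ⟨l1.trans_le hz.1, hz.2.1.trans_lt u2, u3.trans_le (neg_le_neg hz.2.2.2),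
    (neg_le_neg hz.2.2.1).trans_lt l4⟩

theorem norm_lt_of_mem_cpts {R : Rect} {q : ℚ} (hq : 0 < q)
    (hR : ∀ z ∈ R.pts, z.re ^ 2 + z.im ^ 2 < q ^ 2) {z : ℂ} (hz : z ∈ R.cpts) : ‖z‖ < q := by
  have key : ∀ {a b : ℚ} {x : ℝ}, (a : ℝ) < x → x < b → ∃ r : ℚ, a < r ∧ r < b ∧ x ^ 2 ≤ r ^ 2 := by
    intro a b x ha hb
    rcases le_total 0 x with h | h
    · obtain ⟨r, h1, h2⟩ := exists_rat_btwn hb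
      exact ⟨r, by exact_mod_cast ha.trans h1, by exact_mod_cast h2, by nlinarith⟩
    · obtain ⟨r, h1, h2⟩ := exists_rat_btwn ha
      exact ⟨r, by exact_mod_cast h1, by exact_mod_cast h2.trans hb, by nlinarith⟩
  obtain ⟨x, x1, x2, x3⟩ := key hz.1 hz.2.1
  obtain ⟨y, y1, y2, y3⟩ := key hz.2.2.1 hz.2.2.2
  have h : ((x ^ 2 + y ^ 2 : ℚ) : ℝ) < (q ^ 2 : ℚ) :=
    Rat.cast_lt.2 (hR ⟨x, y⟩ ⟨x1, x2, y1, y2⟩)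
  push_cast at h
  refine lt_of_pow_lt_pow_left₀ 2 (by positivity) ?_
  rw [Complex.sq_norm, Complex.normSq_apply]
  nlinarith

/-- An interval is covered by finitely many intervals of length at most `δ`. -/
theorem exists_fine_intervals (a b : ℚ) {δ : ℚ} (hδ : 0 < δ) :
    ∃ L : List (ℚ × ℚ), (∀ x, a < x → x < b → ∃ I ∈ L, I.1 < x ∧ x < I.2) ∧
      ∀ I ∈ L, a ≤ I.1 ∧ I.2 ≤ b ∧ I.2 - I.1 ≤ δ := by
  have hη : 0 < δ / 2 := half_pos hδ
  refine ⟨(List.range (⌊(b - a) / (δ / 2)⌋₊ + 1)).map fun i : ℕ =>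
    (max a (a + (i - 1) * (δ / 2)), min b (a + (i + 1) * (δ / 2))), fun x hx hx' => ?_, ?_⟩
  · have h0 : 0 ≤ (x - a) / (δ / 2) := by have := sub_pos.2 hx; positivity
    have h1 := Nat.floor_le h0
    have h2 := Nat.lt_floor_add_one ((x - a) / (δ / 2))
    rw [le_div_iff₀ hη] at h1
    rw [div_lt_iff₀ hη] at h2
    refine ⟨_, List.mem_map_of_mem (List.mem_range.2 (Nat.lt_succ_of_le
      (Nat.floor_le_floor (a := (x - a) / (δ / 2)) (by gcongr)))), max_lt hx ?_, lt_min hx' ?_⟩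
    · linarith
    · linarith
  · intro I hI
    obtain ⟨i, -, rfl⟩ := List.mem_map.1 hI
    refine ⟨le_max_left _ _, min_le_left _ _, ?_⟩
    have h1 := le_max_right a (a + ((i : ℚ) - 1) * (δ / 2))
    have h2 := min_le_right b (a + ((i : ℚ) + 1) * (δ / 2))
    simp only
    linarith

/-- A rectangle is covered by finitely many rectangles with sides at most `δ`. -/
theorem exists_fine_cover (R : Rect) {δ : ℚ} (hδ : 0 < δ) :
    ∃ L : List Rect, (∀ z ∈ R.pts, ∃ P ∈ L, z ∈ P.pts) ∧
      ∀ P ∈ L, P.pts ⊆ R.pts ∧ P.hi.re - P.lo.re ≤ δ ∧ P.hi.im - P.lo.im ≤ δ := by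
  obtain ⟨L, h1, h2⟩ := exists_fine_intervals R.lo.re R.hi.re hδ
  obtain ⟨M, k1, k2⟩ := exists_fine_intervals R.lo.im R.hi.im hδ
  refine ⟨(L ×ˢ M).map fun p => ⟨⟨p.1.1, p.2.1⟩, ⟨p.1.2, p.2.2⟩⟩, fun z hz => ?_, ?_⟩
  · obtain ⟨I, hI, a1, a2⟩ := h1 _ hz.1 hz.2.1
    obtain ⟨I', hI', b1, b2⟩ := k1 _ hz.2.2.1 hz.2.2.2
    exact ⟨_, List.mem_map_of_mem (List.mem_product.2 ⟨hI, hI'⟩), a1, a2, b1, b2⟩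
  · intro P hP
    obtain ⟨⟨I, I'⟩, hI, rfl⟩ := List.mem_map.1 hP
    obtain ⟨hI, hI'⟩ := List.mem_product.1 hI
    obtain ⟨a1, a2, a3⟩ := h2 _ hI
    obtain ⟨b1, b2, b3⟩ := k2 _ hI'
    refine ⟨fun z hz => ?_, a3, b3⟩
    exact ⟨a1.trans_lt hz.1, hz.2.1.trans_le a2, b1.trans_lt hz.2.2.1, hz.2.2.2.trans_le b2⟩

end Rect

variable {C : Type u} [Category.{v} C] {J : GrothendieckTopology C}

/-! ### Elements bounded at a stage -/

namespace CStarSeminormed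

section

variable {A : CStarSeminormed.{w} J} {U V : C}

theorem normLT_res {a : A.El U} {q : PosRat} (f : V ⟶ U) :
    A.NormLT (A.res f a) q ↔ (A.norm a).lt q f := by
  rw [NormLT, A.norm_res]
  change ((A.norm a).lt q).pullback f (𝟙 V) ↔ _
  rw [Sieve.pullback_apply, Category.id_comp]

theorem NormLT.res {a : A.El U} {q : PosRat} (h : A.NormLT a q) (f : V ⟶ U) :
    A.NormLT (A.res f a) q := by
  rw [normLT_res]
  simpa using ((A.norm a).lt q).downward_closed h f

theorem res_comp {W : C} (g : W ⟶ V) (f : V ⟶ U) (a : A.El U) :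
    A.res (g ≫ f) a = A.res g (A.res f a) :=
  congrArg (fun k => k.hom a) (A.alg.map_comp f.op g.op)

theorem res_id (a : A.El U) : A.res (𝟙 U) a = a :=
  congrArg (fun k => k.hom a) (A.alg.map_id (op U))

theorem normLT_of_cover {a : A.El U} {q : PosRat} {S : Sieve U} (hS : S ∈ J U)
    (h : ∀ ⦃V : C⦄ (f : V ⟶ U), S f → A.NormLT (A.res f a) q) : A.NormLT a q := by
  refine (A.norm a).closed q (𝟙 U) ?_
  rw [GrothendieckTopology.Covers, Sieve.pullback_id]
  exact J.superset_covering (fun V f hf => (normLT_res f).1 (h f hf)) hS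

theorem NormLT.mono {a : A.El U} {q q' : PosRat} (h : A.NormLT a q) (hq : q ≤ q') :
    A.NormLT a q' := (A.norm a).upward q q' hq _ h

theorem NormLT.add {a b : A.El U} {q r : PosRat} (ha : A.NormLT a q) (hb : A.NormLT b r) :
    A.NormLT (a + b) (q + r) :=
  A.norm_add a b _ _ (UpperReal.image₂_of _ _ _ rfl ha hb)

theorem NormLT.mul {a b : A.El U} {q r : PosRat} (ha : A.NormLT a q) (hb : A.NormLT b r) :
    A.NormLT (a * b) (q * r) :=
  A.norm_mul a b _ _ (UpperReal.image₂_of _ _ _ rfl ha hb)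

theorem NormLT.star {a : A.El U} {q : PosRat} (ha : A.NormLT a q) : A.NormLT (star a) q := by
  rwa [NormLT, A.norm_star]

theorem normLT_of_mul_star {a : A.El U} {q : PosRat} (h : A.NormLT (a * star a) (q * q)) :
    A.NormLT a q := by
  rw [NormLT, A.norm_mul_star] at h
  refine UpperReal.image₂_le _ _ _ _ _ ((A.norm a).closed q) ?_ _ h
  intro r s hrs V f hr hs
  rcases le_total r q with h | h
  · exact (A.norm a).upward _ _ h _ hr
  · refine (A.norm a).upward _ _ ?_ _ hs
    by_contra hlt
    exact absurd (congrArg Subtype.val hrs) (mul_lt_mul_of_le_of_lt_of_nonneg_of_pos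
      (show q.1 ≤ r.1 from h) (show q.1 < s.1 from not_le.1 hlt) q.2.le r.2).ne'

theorem NormLT.neg {a : A.El U} {q : PosRat} (ha : A.NormLT a q) : A.NormLT (-a) q := by
  refine normLT_of_mul_star ?_
  rw [star_neg, neg_mul_neg]
  exact ha.mul ha.star

theorem NormLT.sub {a b : A.El U} {q r : PosRat} (ha : A.NormLT a q) (hb : A.NormLT b r) :
    A.NormLT (a - b) (q + r) := by
  rw [sub_eq_add_neg]
  exact ha.add hb.neg

theorem normLT_zero (U : C) (q : PosRat) : A.NormLT (0 : A.El U) q := by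
  rw [NormLT, A.norm_zero]
  exact J.le_close _ _ q.2

theorem star_algebraMap (U : C) (z : CRat) :
    star (algebraMap CRat (A.El U) z) = algebraMap CRat (A.El U) (star z) := by
  have := A.star_smul (op U) z 1
  rwa [star_one, ← Algebra.algebraMap_eq_smul_one, ← Algebra.algebraMap_eq_smul_one] at this

theorem normLT_algebraMap (U : C) {z : CRat} {q : PosRat} (h : z.re ^ 2 + z.im ^ 2 < q.1 ^ 2) :
    A.NormLT (algebraMap CRat (A.El U) z) q := by
  refine normLT_of_mul_star ?_
  have e : z * star z = algebraMap ℚ CRat (z.re ^ 2 + z.im ^ 2) := by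
    rw [QuadraticAlgebra.algebraMap_eq]
    ext
    · simp
      ring
    · simp
      ring
  rw [star_algebraMap, ← map_mul, e, Algebra.algebraMap_eq_smul_one, NormLT, A.norm_smul,
    A.norm_one, abs_of_nonneg (by positivity)]
  obtain ⟨r, h1, h2⟩ := exists_between h
  have hr : 0 < r := lt_of_le_of_lt (by positivity) h1
  refine UpperReal.image₂_of _ _ _ (r := ⟨r, hr⟩) (s := ⟨q.1 ^ 2 / r, div_pos (pow_pos q.2 2) hr⟩)
    (Subtype.ext ?_) (J.le_close _ _ h1) (J.le_close _ _ ?_)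
  · change r * (q.1 ^ 2 / r) = q.1 * q.1
    field_simp
  · exact (one_lt_div hr).2 h2

variable (A U)

/-- The ring of those elements at stage `U` whose norm is bounded by a single rational number at
that stage; an arbitrary element is so only on a cover. -/
def bounded : Subring (A.El U) where
  carrier := {a | ∃ q, A.NormLT a q}
  mul_mem' := fun ⟨_, ha⟩ ⟨_, hb⟩ => ⟨_, ha.mul hb⟩
  one_mem' := ⟨⟨2, by norm_num⟩, by
    rw [← map_one (algebraMap CRat (A.El U))]
    exact normLT_algebraMap U (show (1 : ℚ) ^ 2 + 0 ^ 2 < 2 ^ 2 by norm_num)⟩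
  add_mem' := fun ⟨_, ha⟩ ⟨_, hb⟩ => ⟨_, ha.add hb⟩
  zero_mem' := ⟨⟨1, one_pos⟩, normLT_zero U _⟩
  neg_mem' := fun ⟨_, ha⟩ => ⟨_, ha.neg⟩

theorem cover_bounded (a : A.El U) : ∃ S ∈ J U, ∀ ⦃V : C⦄ (f : V ⟶ U), S f →
    A.res f a ∈ A.bounded V := by
  refine ⟨_, (J.close_eq_top_iff_mem _).1 (A.norm a).inhabited, ?_⟩
  rintro V f ⟨_, ⟨q, rfl⟩, hq⟩
  exact ⟨q, (normLT_res f).2 hq⟩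

variable {A U}

theorem bounded_res {a : A.El U} (h : a ∈ A.bounded U) (f : V ⟶ U) :
    A.res f a ∈ A.bounded V := h.imp fun _ h => h.res f

/-- The infimum of the rational bounds of an element, an external real number. -/
noncomputable def realNorm (a : A.El U) : ℝ := sInf {t | ∃ q : PosRat, A.NormLT a q ∧ (q.1 : ℝ) = t}

theorem bddBelow_bounds (a : A.El U) :
    BddBelow {t : ℝ | ∃ q : PosRat, A.NormLT a q ∧ (q.1 : ℝ) = t} :=
  ⟨0, by rintro _ ⟨q, -, rfl⟩; exact_mod_cast q.2.le⟩

theorem realNorm_nonneg (a : A.El U) : 0 ≤ realNorm a :=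
  Real.sInf_nonneg (by rintro _ ⟨q, -, rfl⟩; exact_mod_cast q.2.le)

theorem NormLT.realNorm_le {a : A.El U} {q : PosRat} (h : A.NormLT a q) : realNorm a ≤ q.1 :=
  csInf_le (bddBelow_bounds a) ⟨q, h, rfl⟩

theorem normLT_of_realNorm_lt {a : A.El U} (ha : a ∈ A.bounded U) {q : PosRat}
    (h : realNorm a < q.1) : A.NormLT a q := by
  obtain ⟨p, hp⟩ := ha
  obtain ⟨_, ⟨r, hr, rfl⟩, hrq⟩ := exists_lt_of_csInf_lt
    (show Set.Nonempty {t | ∃ q : PosRat, A.NormLT a q ∧ (q.1 : ℝ) = t} from ⟨_, p, hp, rfl⟩) h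
  exact NormLT.mono hr (show r.1 ≤ q.1 by exact_mod_cast hrq.le)

/-- To bound the real norm from above it suffices to bound it by all larger positive rationals. -/
theorem realNorm_le_of_forall {a : A.El U} {c : ℝ} (hc : 0 ≤ c)
    (h : ∀ q : PosRat, c < q.1 → realNorm a ≤ q.1) : realNorm a ≤ c := by
  refine le_of_forall_gt_imp_ge_of_dense fun t ht => ?_
  obtain ⟨q, h1, h2⟩ := exists_rat_btwn ht
  exact (h ⟨q, by exact_mod_cast hc.trans_lt h1⟩ h1).trans h2.le

theorem exists_normLT_of_realNorm_lt {a : A.El U} (ha : a ∈ A.bounded U) {t : ℝ}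
    (h : realNorm a < t) : ∃ q : PosRat, A.NormLT a q ∧ (q.1 : ℝ) < t := by
  obtain ⟨q, h1, h2⟩ := exists_rat_btwn h
  have hq : 0 < q := by exact_mod_cast (realNorm_nonneg a).trans_lt h1
  exact ⟨⟨q, hq⟩, normLT_of_realNorm_lt ha h1, h2⟩

theorem realNorm_add_le {a b : A.El U} (ha : a ∈ A.bounded U) (hb : b ∈ A.bounded U) :
    realNorm (a + b) ≤ realNorm a + realNorm b := by
  refine le_of_forall_pos_le_add fun ε hε => ?_
  obtain ⟨q, h1, h2⟩ := exists_normLT_of_realNorm_lt ha (lt_add_of_pos_right _ (half_pos hε))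
  obtain ⟨r, k1, k2⟩ := exists_normLT_of_realNorm_lt hb (lt_add_of_pos_right _ (half_pos hε))
  have := (h1.add k1).realNorm_le
  change _ ≤ ((q.1 + r.1 : ℚ) : ℝ) at this
  push_cast at this
  linarith

theorem realNorm_mul_le {a b : A.El U} (ha : a ∈ A.bounded U) (hb : b ∈ A.bounded U) :
    realNorm (a * b) ≤ realNorm a * realNorm b := by
  refine le_of_forall_gt_imp_ge_of_dense fun t ht => ?_
  have hc : Filter.Tendsto (fun ε : ℝ => (realNorm a + ε) * (realNorm b + ε))
      (nhdsWithin 0 (Set.Ioi 0)) (nhds (realNorm a * realNorm b)) := by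
    have : Continuous fun ε : ℝ => (realNorm a + ε) * (realNorm b + ε) := by fun_prop
    simpa using (this.tendsto 0).mono_left nhdsWithin_le_nhds
  obtain ⟨ε, hε, hε0⟩ := ((hc.eventually (gt_mem_nhds ht)).and self_mem_nhdsWithin).exists
  obtain ⟨q, h1, h2⟩ := exists_normLT_of_realNorm_lt ha (lt_add_of_pos_right _ hε0)
  obtain ⟨r, k1, k2⟩ := exists_normLT_of_realNorm_lt hb (lt_add_of_pos_right _ hε0)
  have := (h1.mul k1).realNorm_le
  change _ ≤ ((q.1 * r.1 : ℚ) : ℝ) at this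
  push_cast at this
  have hq : (0 : ℝ) ≤ q.1 := by exact_mod_cast q.2.le
  have hr : (0 : ℝ) ≤ r.1 := by exact_mod_cast r.2.le
  exact this.trans ((mul_le_mul h2.le k2.le hr (hq.trans h2.le)).trans hε.le)

theorem realNorm_star (a : A.El U) : realNorm (star a) = realNorm a := by
  simp only [realNorm, NormLT, A.norm_star]

theorem realNorm_neg (a : A.El U) : realNorm (-a) = realNorm a := by
  have : ∀ q, A.NormLT (-a) q ↔ A.NormLT a q :=
    fun q => ⟨fun h => by simpa using h.neg, fun h => h.neg⟩
  simp only [realNorm, this]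

theorem star_mem_bounded {a : A.El U} (ha : a ∈ A.bounded U) : star a ∈ A.bounded U :=
  ha.imp fun _ h => h.star

theorem realNorm_mul_star {a : A.El U} (ha : a ∈ A.bounded U) :
    realNorm (a * star a) = realNorm a * realNorm a := by
  refine le_antisymm ?_ ?_
  · simpa only [realNorm_star] using realNorm_mul_le ha (star_mem_bounded ha)
  · rw [← sq]
    refine Real.sq_sqrt (realNorm_nonneg (a * star a)) ▸
      pow_le_pow_left₀ (realNorm_nonneg a) (realNorm_le_of_forall (Real.sqrt_nonneg _)
        fun q hq => NormLT.realNorm_le (normLT_of_mul_star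
          (normLT_of_realNorm_lt (mul_mem ha (star_mem_bounded ha)) ?_))) 2
    have hq0 : (0 : ℝ) < q.1 := by exact_mod_cast q.2
    change _ < ((q.1 * q.1 : ℚ) : ℝ)
    push_cast
    rw [← sq]
    exact (Real.sqrt_lt' hq0).1 hq

theorem realNorm_algebraMap_le (U : C) (z : CRat) :
    realNorm (algebraMap CRat (A.El U) z) ≤ ‖CRat.toComplex z‖ := by
  refine realNorm_le_of_forall (norm_nonneg _) fun q hq => (normLT_algebraMap U ?_).realNorm_le
  have h := pow_lt_pow_left₀ hq (norm_nonneg _) two_ne_zero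
  rw [Complex.sq_norm, Complex.normSq_apply, CRat.toComplex_re, CRat.toComplex_im] at h
  have : ((z.re ^ 2 + z.im ^ 2 : ℚ) : ℝ) < ((q.1 ^ 2 : ℚ) : ℝ) := by push_cast; linarith
  exact_mod_cast this

theorem algebraMap_mem_bounded (U : C) (z : CRat) :
    algebraMap CRat (A.El U) z ∈ A.bounded U := by
  refine ⟨⟨z.re ^ 2 + z.im ^ 2 + 1, by positivity⟩, normLT_algebraMap U ?_⟩
  change _ < (z.re ^ 2 + z.im ^ 2 + 1) ^ 2
  nlinarith [sq_nonneg z.re, sq_nonneg z.im]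

end

variable {A : CStarSeminormed.{w} J} {U : C}

/-- The bounded elements at a stage, as a seminormed ring in the external sense. -/
noncomputable instance : SeminormedCommRing (A.bounded U) :=
  { AddGroupSeminorm.toSeminormedAddCommGroup (E := A.bounded U)
      { toFun := fun a => realNorm a.1
        map_zero' := le_antisymm (realNorm_le_of_forall le_rfl
          fun q _ => (normLT_zero U q).realNorm_le) (realNorm_nonneg _)
        add_le' := fun a b => realNorm_add_le a.2 b.2
        neg' := fun a => realNorm_neg a.1 },
    (inferInstance : CommRing (A.bounded U)) with
    norm_mul_le := fun a b => realNorm_mul_le a.2 b.2 }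

theorem norm_bounded_def (a : A.bounded U) : ‖a‖ = realNorm a.1 := rfl

instance : StarRing (A.bounded U) where
  star a := ⟨star a.1, star_mem_bounded a.2⟩
  star_involutive a := Subtype.ext (star_star a.1)
  star_mul a b := Subtype.ext (star_mul a.1 b.1)
  star_add a b := Subtype.ext (star_add a.1 b.1)

variable (A U) in
/-- The complex rationals, as bounded elements. -/
def scalarHom : CRat →+* A.bounded U :=
  (algebraMap CRat (A.El U)).codRestrict (A.bounded U) (algebraMap_mem_bounded U)

/-- The bounded elements are, up to isometry, a dense subring of the continuous functions on a
compact space. -/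
theorem exists_gelfand_bounded (A : CStarSeminormed.{w} J) (U : C) :
    ∃ (X : Type w) (_ : TopologicalSpace X) (_ : CompactSpace X) (Γ : A.bounded U →+* C(X, ℂ)),
      (∀ x, ‖Γ x‖ = ‖x‖) ∧ (∀ x, Γ (star x) = star (Γ x)) ∧
      (∀ z, Γ (A.scalarHom U z) = algebraMap ℂ _ (CRat.toComplex z)) ∧ DenseRange Γ :=
  exists_isometric_denseRange_continuousMap (A.bounded U) (fun x => realNorm_star x.1)
    (fun x => realNorm_mul_star x.2) (A.scalarHom U) (realNorm_algebraMap_le U)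
    (fun z => Subtype.ext (star_algebraMap U z))

/-- A character of the bounded elements at stage `U`.  It is encoded as a function on all elements,
whose values at unbounded elements are irrelevant. -/
structure IsCharacter (φ : A.El U → ℂ) : Prop where
  map_algebraMap : ∀ z : CRat, φ (algebraMap CRat (A.El U) z) = CRat.toComplex z
  map_add : ∀ a ∈ A.bounded U, ∀ b ∈ A.bounded U, φ (a + b) = φ a + φ b
  map_mul : ∀ a ∈ A.bounded U, ∀ b ∈ A.bounded U, φ (a * b) = φ a * φ b
  map_star : ∀ a ∈ A.bounded U, φ (star a) = star (φ a)
  norm_le : ∀ a q, A.NormLT a q → ‖φ a‖ ≤ q.1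

theorem IsCharacter.comp_res {V : C} {φ : A.El V → ℂ} (h : IsCharacter φ) (f : V ⟶ U) :
    IsCharacter (A := A) fun a : A.El U => φ (A.res f a) where
  map_algebraMap z := by rw [AlgHom.commutes]; exact h.map_algebraMap z
  map_add a ha b hb := by
    rw [_root_.map_add]
    exact h.map_add _ (bounded_res ha f) _ (bounded_res hb f)
  map_mul a ha b hb := by
    rw [_root_.map_mul]
    exact h.map_mul _ (bounded_res ha f) _ (bounded_res hb f)
  map_star a ha := by rw [A.star_res]; exact h.map_star _ (bounded_res ha f)
  norm_le a q hq := h.norm_le _ _ (hq.res f)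

/-- There are enough characters to compute the norm. -/
theorem normLT_of_forall_character {a : A.El U} (ha : a ∈ A.bounded U) {q : PosRat}
    (h : ∀ φ : A.El U → ℂ, IsCharacter φ → ‖φ a‖ < q.1) : A.NormLT a q := by
  obtain ⟨X, _, _, Γ, h1, h2, h3, -⟩ := exists_gelfand_bounded A U
  have hq : (0 : ℝ) < q.1 := by exact_mod_cast q.2
  refine normLT_of_realNorm_lt ha ?_
  have := h1 ⟨a, ha⟩
  rw [norm_bounded_def] at this
  rw [← this, ContinuousMap.norm_lt_iff _ hq]
  intro x
  classical
  let φ : A.El U → ℂ := fun b => if hb : b ∈ A.bounded U then Γ ⟨b, hb⟩ x else 0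
  have hφ : ∀ b (hb : b ∈ A.bounded U), φ b = Γ ⟨b, hb⟩ x := fun b hb => dif_pos hb
  rw [← hφ]
  refine h φ ⟨fun z => ?_, fun b hb c hc => ?_, fun b hb c hc => ?_, fun b hb => ?_,
    fun b r hb => ?_⟩
  · rw [hφ _ (algebraMap_mem_bounded U z)]
    exact congrArg (fun f : C(X, ℂ) => f x) (h3 z)
  · rw [hφ _ hb, hφ _ hc, hφ _ (add_mem hb hc)]
    exact congrArg (fun f : C(X, ℂ) => f x) (map_add Γ ⟨b, hb⟩ ⟨c, hc⟩)
  · rw [hφ _ hb, hφ _ hc, hφ _ (mul_mem hb hc)]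
    exact congrArg (fun f : C(X, ℂ) => f x) (map_mul Γ ⟨b, hb⟩ ⟨c, hc⟩)
  · rw [hφ _ hb, hφ _ (star_mem_bounded hb)]
    exact congrArg (fun f : C(X, ℂ) => f x) (h2 ⟨b, hb⟩)
  · rw [hφ _ ⟨r, hb⟩]
    exact ((Γ ⟨b, ⟨r, hb⟩⟩).norm_coe_le_norm x).trans ((h1 _).le.trans hb.realNorm_le)

end CStarSeminormed

namespace CommCStarAlgebra

open CStarSeminormed

variable {A : CommCStarAlgebra.{w} J} {U : C}

/-- The Cauchy approximation given by the singletons of the members of a Cauchy sequence. -/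
def approxOfSeq (u : ℕ → A.bounded U) (hu : CauchySeq u) : A.CauchyApprox U where
  mem n V f a := a = A.res f (u n).1
  mem_res n V W f g a h := by rw [h, res_comp]
  mem_glue n V f a S hS h := by
    refine (A.isSheaf S hS).isSeparatedFor.ext fun W g hg => ?_
    exact (h g hg).trans (res_comp g f _)
  inhabited n := ⟨⊤, J.top_mem U, fun V f _ => ⟨_, rfl⟩⟩
  cauchy ε := by
    obtain ⟨m, hm⟩ := Metric.cauchySeq_iff.1 hu ε.1 (by exact_mod_cast ε.2)
    refine ⟨⊤, J.top_mem U, fun V f _ => ⟨m, fun n hn n' hn' W g a a' ha ha' => ?_⟩⟩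
    rw [ha, ha', ← map_sub]
    refine NormLT.res (normLT_of_realNorm_lt (u n - u n').2 ?_) _
    rw [← norm_bounded_def, ← dist_eq_norm]
    exact hm n hn n' hn'

instance : CompleteSpace (A.bounded U) := by
  refine Metric.complete_of_cauchySeq_tendsto fun u hu => ?_
  obtain ⟨b, hb, -⟩ := A.complete U (approxOfSeq u hu)
  have key : ∀ ε : PosRat, ∃ M, ∀ n ≥ M, A.NormLT ((u n).1 - b) ε := fun ε => by
    have hε : 0 < ε.1 / 2 := half_pos ε.2
    obtain ⟨M, hM⟩ := Metric.cauchySeq_iff.1 hu ((ε.1 / 2 : ℚ) : ℝ) (by exact_mod_cast hε)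
    obtain ⟨S, hS, h⟩ := hb ⟨_, hε⟩
    refine ⟨M, fun n hn => normLT_of_cover hS fun V f hf => ?_⟩
    obtain ⟨m, hm⟩ := h f hf
    have h1 := hm (max m M) (le_max_left _ _) (𝟙 V) (A.res f (u (max m M)).1)
      (by rw [Category.id_comp]; rfl)
    have h2 : A.NormLT (U := U) ((u n).1 - (u (max m M)).1) ⟨_, hε⟩ := by
      refine normLT_of_realNorm_lt (u n - u (max m M)).2 ?_
      rw [← norm_bounded_def, ← dist_eq_norm]
      exact hM n hn _ (le_max_right _ _)
    rw [Category.id_comp] at h1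
    have h3 := (h2.res f).add h1
    rw [map_sub, sub_add_sub_cancel, ← map_sub] at h3
    exact h3.mono (show ε.1 / 2 + ε.1 / 2 ≤ ε.1 by linarith)
  have hbb : b ∈ A.bounded U := by
    obtain ⟨M, hM⟩ := key ⟨1, one_pos⟩
    have := sub_mem (u M).2 (⟨_, hM M le_rfl⟩ : (u M).1 - b ∈ A.bounded U)
    rwa [sub_sub_cancel] at this
  refine ⟨⟨b, hbb⟩, Metric.tendsto_atTop.2 fun t ht => ?_⟩
  obtain ⟨ε, h1, h2⟩ := exists_rat_btwn ht
  obtain ⟨M, hM⟩ := key ⟨ε, by exact_mod_cast h1⟩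
  refine ⟨M, fun n hn => ?_⟩
  rw [dist_eq_norm]
  exact lt_of_le_of_lt (hM n hn).realNorm_le h2

theorem eq_zero_of_normLT {a : A.El U} (h : ∀ q, A.NormLT a q) : a = 0 := by
  -- both `a` and `0` are limits of the constant sequence `0`
  have hu : CauchySeq fun _ : ℕ => (0 : A.bounded U) := cauchySeq_const _
  refine (A.complete U (approxOfSeq _ hu)).unique (fun ε => ?_) fun ε => ?_
  · refine ⟨⊤, J.top_mem U, fun V f _ => ⟨0, fun n _ W g b hb => ?_⟩⟩
    rw [show b = A.res (g ≫ f) 0 from hb, map_zero, zero_sub]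
    exact ((h ε).res _).neg
  · refine ⟨⊤, J.top_mem U, fun V f _ => ⟨0, fun n _ W g b hb => ?_⟩⟩
    rw [show b = A.res (g ≫ f) 0 from hb, sub_self]
    exact normLT_zero _ _

/-- If `‖a‖ < q`, then `q² - a a*` is the square of a selfadjoint element. -/
theorem exists_selfAdjoint_sq {a : A.El U} {q : PosRat} (h : A.NormLT a q) :
    ∃ y : A.El U, star y = y ∧
      y * y + a * star a = algebraMap CRat (A.El U) (algebraMap ℚ CRat (q.1 * q.1)) := by
  obtain ⟨X, _, _, Γ, h1, h2, h3, h4⟩ := exists_gelfand_bounded A.toCStarSeminormed U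
  have hΓ : Isometry Γ := AddMonoidHomClass.isometry_of_norm Γ h1
  -- the range is dense and, since the bounded elements are complete, closed
  have hs : Function.Surjective Γ := by
    rw [← Set.range_eq_univ, ← hΓ.isUniformInducing.isComplete_range.isClosed.closure_eq]
    exact h4.closure_range
  have hi : Function.Injective Γ := fun b c hbc => by
    refine sub_eq_zero.1 (Subtype.ext (eq_zero_of_normLT fun p => ?_))
    refine normLT_of_realNorm_lt (b - c).2 ?_
    rw [← norm_bounded_def, ← h1, map_sub, hbc, sub_self, _root_.norm_zero]
    exact_mod_cast p.2
  let a' : A.bounded U := ⟨a, q, h⟩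
  have ha : ∀ x, 0 ≤ (q.1 : ℝ) ^ 2 - ‖Γ a' x‖ ^ 2 := fun x => by
    have := ((Γ a').norm_coe_le_norm x).trans ((h1 a').le.trans h.realNorm_le)
    exact sub_nonneg.2 (pow_le_pow_left₀ (norm_nonneg _) this 2)
  obtain ⟨y, hy⟩ := hs ⟨fun x => (Real.sqrt ((q.1 : ℝ) ^ 2 - ‖Γ a' x‖ ^ 2) : ℂ), by fun_prop⟩
  have hyx : ∀ x, Γ y x = (Real.sqrt ((q.1 : ℝ) ^ 2 - ‖Γ a' x‖ ^ 2) : ℂ) := fun x => by rw [hy]; rfl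
  refine ⟨y.1, congrArg Subtype.val (hi (?_ : Γ (star y) = Γ y)), congrArg Subtype.val
    (hi (?_ : Γ (y * y + a' * star a') = Γ (A.scalarHom U (algebraMap ℚ CRat (q.1 * q.1)))))⟩
  · rw [h2]
    ext x
    rw [ContinuousMap.star_apply, hyx]
    exact Complex.conj_ofReal _
  · rw [h3, map_add, map_mul, map_mul, h2]
    ext x
    simp only [ContinuousMap.add_apply, ContinuousMap.mul_apply, ContinuousMap.star_apply, hyx]
    rw [← Complex.ofReal_mul, Real.mul_self_sqrt (ha x), RCLike.star_def, Complex.mul_conj,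
      Complex.normSq_eq_norm_sq, ← Complex.ofReal_add, sub_add_cancel]
    apply Complex.ext <;>
      simp [Algebra.algebraMap_eq_smul_one (A := C(X, ℂ)), QuadraticAlgebra.algebraMap_eq, sq]

end CommCStarAlgebra

/-! ### A bound on the Gelfand transform gives a bound on the norm -/

namespace CommCStarAlgebra

open CStarSeminormed

variable {A : CommCStarAlgebra.{w} J} {U V W : C}

theorem mem_res_iff {f : V ⟶ U} {l : A.MFn.Fin U} {x : A.El V × Rect} :
    x ∈ A.MFn.res f l ↔ ∃ y : A.El U × Rect, y ∈ l ∧ (A.res f y.1, y.2) = x :=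
  List.mem_map

/-- `m'` refines `m` if it confines each element that occurs in `m` to a rectangle well inside the
one that `m` names. -/
def Refines (m' m : List (A.El W × Rect)) : Prop :=
  ∀ x ∈ m, ∃ R' : Rect, (x.1, R') ∈ m' ∧ R'.WellInside x.2

theorem Refines.res {m' m : A.MFn.Fin W} (h : Refines (A := A) m' m) (f : V ⟶ W) :
    Refines (A := A) (A.MFn.res f m') (A.MFn.res f m) := by
  intro x hx
  obtain ⟨y, hy, rfl⟩ := mem_res_iff.1 hx
  obtain ⟨R', hR', hw⟩ := h y hy
  exact ⟨R', mem_res_iff.2 ⟨_, hR', rfl⟩, hw⟩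

/-- Those stages at which every character that satisfies the constraints `m` takes `b` to a number
of absolute value less than `q`. -/
def control (b : A.El U) (q : PosRat) (k : W ⟶ U) (m : A.MFn.Fin W) : Sieve W where
  arrows V h := ∀ φ : A.El V → ℂ, IsCharacter φ →
    (∀ x : A.El W × Rect, x ∈ m → φ (A.res h x.1) ∈ x.2.cpts) → ‖φ (A.res (h ≫ k) b)‖ < q.1
  downward_closed {V V'} h H g φ hφ hm := by
    have := H _ (hφ.comp_res g) fun x hx => by rw [← res_comp]; exact hm x hx
    rwa [← res_comp, ← Category.assoc] at this

theorem pullback_control (b : A.El U) (q : PosRat) (k : W ⟶ U) (m : A.MFn.Fin W) (h : V ⟶ W) :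
    (control b q k m).pullback h = control b q (h ≫ k) (A.MFn.res h m) := by
  ext V' g
  refine forall₂_congr fun φ hφ => ?_
  rw [Category.assoc]
  refine imp_congr_left ⟨fun H x hx => ?_, fun H x hx => ?_⟩
  · obtain ⟨y, hy, rfl⟩ := mem_res_iff.1 hx
    rw [← res_comp]
    exact H y hy
  · rw [res_comp]
    exact H _ (mem_res_iff.2 ⟨x, hx, rfl⟩)

theorem cover_bounded_list (as : List (A.El W)) : ∃ S ∈ J W, ∀ ⦃V : C⦄ (f : V ⟶ W), S f →
    ∀ a ∈ as, A.res f a ∈ A.bounded V := by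
  induction as with
  | nil => exact ⟨⊤, J.top_mem W, by simp⟩
  | cons a as ih =>
    obtain ⟨S, hS, h⟩ := ih
    obtain ⟨T, hT, k⟩ := cover_bounded A.toCStarSeminormed W a
    exact ⟨S ⊓ T, J.intersection_covering hS hT, fun V f hf =>
      List.forall_mem_cons.2 ⟨k f hf.2, h f hf.1⟩⟩

theorem exists_covering_le {α : Type*} (T : List α) (s : α → Sieve W) (h : ∀ x ∈ T, s x ∈ J W) :
    ∃ S ∈ J W, ∀ x ∈ T, S ≤ s x := by
  induction T with
  | nil => exact ⟨⊤, J.top_mem W, by simp⟩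
  | cons a T ih =>
    obtain ⟨S, hS, k⟩ := ih fun x hx => h x (by simp [hx])
    exact ⟨S ⊓ s a, J.intersection_covering hS (h a (by simp)), List.forall_mem_cons.2
      ⟨inf_le_right, fun x hx => inf_le_left.trans (k x hx)⟩⟩

/-- The property that `|b| < q` on the open `⋀ l`, tested on characters: for every refinement of `l`,
locally all characters satisfying the constraints of the refinement satisfy `|φ b| < q`.  By
passing to refinements, only compact parts of `⋀ l` matter, which is what makes this property
inherited along the infinitary relation `R ≤ ⋁ {R' | R' well inside R}`. -/
def ControlOn (b : A.El U) (q : PosRat) (k : W ⟶ U) (l : A.MFn.Fin W) : Prop :=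
  ∀ ⦃V : C⦄ (g : V ⟶ W) (m : A.MFn.Fin V), Refines (A := A) m (A.MFn.res g l) →
    control b q (g ≫ k) m ∈ J V

theorem ControlOn.res {b : A.El U} {q : PosRat} {k : W ⟶ U} {l : A.MFn.Fin W}
    (h : ControlOn b q k l) (g : V ⟶ W) : ControlOn b q (g ≫ k) (A.MFn.res g l) := by
  intro V' g' m hm
  rw [← Presentation.Opens.res_comp] at hm
  rw [← Category.assoc]
  exact h _ m hm

/-- A sufficient condition for the inheritance along a relation: whenever the elements `as` are
bounded, each character that satisfies `m` satisfies one of finitely many refinements of the right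
hand side. -/
theorem control_mem_of_refinements {b : A.El U} {q : PosRat} {k : W ⟶ U} {S : Set (A.MFn.Fin W)}
    {n m : A.MFn.Fin W} (hS : ∀ l ∈ S, ControlOn b q k (l ++ n)) (hm : Refines (A := A) m n)
    (as : List (A.El W))
    (H : ∀ ⦃V : C⦄ (h : V ⟶ W), (∀ a ∈ as, A.res h a ∈ A.bounded V) →
      ∃ T : List (A.MFn.Fin V), (∀ t ∈ T, ∃ l ∈ S, Refines (A := A) t (A.MFn.res h l)) ∧
        ∀ φ : A.El V → ℂ, IsCharacter φ →
          (∀ x : A.El W × Rect, x ∈ m → φ (A.res h x.1) ∈ x.2.cpts) →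
          ∃ t ∈ T, ∀ x : A.El V × Rect, x ∈ t → φ x.1 ∈ x.2.cpts) :
    control b q k m ∈ J W := by
  obtain ⟨S₀, hS₀, has⟩ := cover_bounded_list as
  refine J.transitive hS₀ _ fun V h hh => ?_
  obtain ⟨T, hT, hφ⟩ := H h (has h hh)
  obtain ⟨S₁, hS₁, k₁⟩ := exists_covering_le T (fun t => control b q (h ≫ k) (t ++ A.MFn.res h m))
    fun t ht => by
      obtain ⟨l, hl, hr⟩ := hT t ht
      have := hS l hl h (t ++ A.MFn.res h m) ?_
      · exact this
      · rw [Presentation.Opens.res_append]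
        intro x hx
        rcases List.mem_append.1 hx with hx | hx
        · obtain ⟨R', h1, h2⟩ := hr x hx
          exact ⟨R', List.mem_append_left _ h1, h2⟩
        · obtain ⟨R', h1, h2⟩ := hm.res h x hx
          exact ⟨R', List.mem_append_right _ h1, h2⟩
  rw [pullback_control]
  refine J.superset_covering (fun V' g hg φ φc hx => ?_) hS₁
  obtain ⟨t, ht, hxt⟩ := hφ _ (φc.comp_res g) fun x hxm => hx _ (mem_res_iff.2 ⟨x, hxm, rfl⟩)
  refine k₁ t ht _ hg φ φc fun x hxt' => ?_
  rcases List.mem_append.1 hxt' with h1 | h1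
  · exact hxt x h1
  · exact hx x h1

theorem refines_singleton {a : A.El W} {R' R : Rect} (h : R'.WellInside R) (g : V ⟶ W) :
    Refines (A := A) [(A.res g a, R')] (A.MFn.res g [(a, R)]) := by
  intro x hx
  obtain ⟨y, hy, rfl⟩ := mem_res_iff.1 hx
  obtain rfl := List.mem_singleton.1 hy
  exact ⟨R', List.mem_singleton.2 rfl, h⟩

/-- The property `ControlOn` is inherited along the relations of the locale of multiplicative
functionals. -/
theorem control_mem_of_rel {b : A.El U} {q : PosRat} {k : W ⟶ U} {n₀ : A.MFn.Fin W}
    {S : Set (A.MFn.Fin W)} (h : A.MFnRel W n₀ S) {n m : A.MFn.Fin W}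
    (hS : ∀ l ∈ S, ControlOn b q k (l ++ n)) (hm : Refines (A := A) m (n₀ ++ n)) :
    control b q k m ∈ J W := by
  have hn : Refines (A := A) m n := fun x hx => hm x (List.mem_append_right _ hx)
  have hn₀ : Refines (A := A) m n₀ := fun x hx => hm x (List.mem_append_left _ hx)
  cases h with
  | complex a _ _ h =>
    cases h with
    | total =>
      refine control_mem_of_refinements hS hn [a] fun V h ha => ?_
      obtain ⟨K, hK⟩ := ha a (by simp)
      let B : ℚ → Rect := fun c => ⟨⟨-c, -c⟩, ⟨c, c⟩⟩
      refine ⟨[[(A.res h a, B (K.1 + 1))]], ?_, fun φ hφ _ => ⟨_, List.mem_singleton.2 rfl, ?_⟩⟩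
      · intro t ht
        obtain rfl := List.mem_singleton.1 ht
        refine ⟨_, ⟨B (K.1 + 2), rfl⟩, refines_singleton ?_ h⟩
        refine ⟨?_, ?_, ?_, ?_⟩ <;> simp only [B] <;> linarith
      · intro x hx
        obtain rfl := List.mem_singleton.1 hx
        have h0 := hφ.norm_le _ _ hK
        have h1 := abs_le.1 ((Complex.abs_re_le_norm _).trans h0)
        have h2 := abs_le.1 ((Complex.abs_im_le_norm _).trans h0)
        refine ⟨?_, ?_, ?_, ?_⟩ <;> simp only [B] <;> push_cast <;> linarith
    | inter R R' =>
      obtain ⟨R₁, h1, w1⟩ := hn₀ (a, R) List.mem_cons_self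
      obtain ⟨R₂, h2, w2⟩ := hn₀ (a, R') (List.mem_cons_of_mem _ List.mem_cons_self)
      refine control_mem_of_refinements hS hn [] fun V h _ => ⟨[[(A.res h a, R₁.inter R₂)]], ?_,
        fun φ hφ hx => ⟨_, List.mem_singleton.2 rfl, ?_⟩⟩
      · intro t ht
        obtain rfl := List.mem_singleton.1 ht
        exact ⟨_, rfl, refines_singleton (w1.inter w2) h⟩
      · intro x hx'
        obtain rfl := List.mem_singleton.1 hx'
        exact Rect.mem_cpts_inter.2 ⟨hx _ h1, hx _ h2⟩
    | cover R L hL =>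
      obtain ⟨R₁, h1, w1⟩ := hn₀ (a, R) List.mem_cons_self
      obtain ⟨σ, hσ, hc⟩ := Rect.exists_wellInside_cover R₁.isCompact_box L
        fun z hz => Rect.cpts_cover hL z (w1.box_subset hz)
      refine control_mem_of_refinements hS hn [] fun V h _ =>
        ⟨L.map fun P => [(A.res h a, σ P)], ?_, fun φ hφ hx => ?_⟩
      · intro t ht
        obtain ⟨P, hP, rfl⟩ := List.mem_map.1 ht
        exact ⟨_, ⟨P, hP, rfl⟩, refines_singleton (hσ P) h⟩
      · obtain ⟨P, hP, hz⟩ := hc _ (R₁.cpts_subset_box (hx _ h1))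
        refine ⟨_, List.mem_map_of_mem hP, fun x hx' => ?_⟩
        obtain rfl := List.mem_singleton.1 hx'
        exact hz
    | inner R =>
      obtain ⟨R₁, h1, w1⟩ := hn₀ (a, R) List.mem_cons_self
      obtain ⟨R₂, w2, w3⟩ := w1.exists_between
      refine control_mem_of_refinements hS hn [] fun V h _ => ⟨[[(A.res h a, R₁)]], ?_,
        fun φ hφ hx => ⟨_, List.mem_singleton.2 rfl, ?_⟩⟩
      · intro t ht
        obtain rfl := List.mem_singleton.1 ht
        exact ⟨_, ⟨R₂, w3, rfl⟩, refines_singleton w2 h⟩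
      · intro x hx'
        obtain rfl := List.mem_singleton.1 hx'
        exact hx _ h1
  | scalar z R hz =>
    obtain ⟨R₁, w1, h1⟩ := Rect.exists_wellInside_subset
      (isCompact_singleton (x := CRat.toComplex z))
      (Set.singleton_subset_iff.2 (Rect.toComplex_mem_cpts.2 hz))
    refine control_mem_of_refinements hS hn [] fun V h _ =>
      ⟨[[(A.res h (algebraMap CRat (A.El W) z), R₁)]], ?_,
        fun φ hφ hx => ⟨_, List.mem_singleton.2 rfl, ?_⟩⟩
    · intro t ht
      obtain rfl := List.mem_singleton.1 ht
      exact ⟨_, rfl, refines_singleton w1 h⟩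
    · intro x hx'
      obtain rfl := List.mem_singleton.1 hx'
      rw [AlgHom.commutes, hφ.map_algebraMap]
      exact h1 rfl
  | add a c R R' P hP =>
    obtain ⟨R₁, h1, w1⟩ := hn₀ (a, R) List.mem_cons_self
    obtain ⟨R₂, h2, w2⟩ := hn₀ (c, R') (List.mem_cons_of_mem _ List.mem_cons_self)
    obtain ⟨P', w3, h3⟩ := Rect.exists_wellInside_subset (P := P)
      ((R₁.isCompact_box.prod R₂.isCompact_box).image (f := fun p : ℂ × ℂ => p.1 + p.2)
        (by fun_prop)) (by
          rintro _ ⟨p, hp, rfl⟩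
          exact Rect.add_mem_cpts w1 w2 hP hp.1 hp.2)
    refine control_mem_of_refinements hS hn [a, c] fun V h hb =>
      ⟨[[(A.res h (a + c), P')]], ?_, fun φ hφ hx => ⟨_, List.mem_singleton.2 rfl, ?_⟩⟩
    · intro t ht
      obtain rfl := List.mem_singleton.1 ht
      exact ⟨_, rfl, refines_singleton w3 h⟩
    · intro x hx'
      obtain rfl := List.mem_singleton.1 hx'
      rw [map_add, hφ.map_add _ (hb a (by simp)) _ (hb c (by simp))]
      exact h3 ⟨(_, _), ⟨R₁.cpts_subset_box (hx _ h1), R₂.cpts_subset_box (hx _ h2)⟩, rfl⟩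
  | mul a c R R' P hP =>
    obtain ⟨R₁, h1, w1⟩ := hn₀ (a, R) List.mem_cons_self
    obtain ⟨R₂, h2, w2⟩ := hn₀ (c, R') (List.mem_cons_of_mem _ List.mem_cons_self)
    obtain ⟨P', w3, h3⟩ := Rect.exists_wellInside_subset (P := P)
      ((R₁.isCompact_box.prod R₂.isCompact_box).image (f := fun p : ℂ × ℂ => p.1 * p.2)
        (by fun_prop)) (by
          rintro _ ⟨p, hp, rfl⟩
          exact Rect.mul_mem_cpts w1 w2 hP hp.1 hp.2)
    refine control_mem_of_refinements hS hn [a, c] fun V h hb =>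
      ⟨[[(A.res h (a * c), P')]], ?_, fun φ hφ hx => ⟨_, List.mem_singleton.2 rfl, ?_⟩⟩
    · intro t ht
      obtain rfl := List.mem_singleton.1 ht
      exact ⟨_, rfl, refines_singleton w3 h⟩
    · intro x hx'
      obtain rfl := List.mem_singleton.1 hx'
      rw [map_mul, hφ.map_mul _ (hb a (by simp)) _ (hb c (by simp))]
      exact h3 ⟨(_, _), ⟨R₁.cpts_subset_box (hx _ h1), R₂.cpts_subset_box (hx _ h2)⟩, rfl⟩
  | star a R P hP =>
    obtain ⟨R₁, h1, w1⟩ := hn₀ (a, R) List.mem_cons_self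
    obtain ⟨P', w3, h3⟩ := Rect.exists_wellInside_subset (P := P)
      (R₁.isCompact_box.image (f := fun z : ℂ => star z) (by fun_prop)) (by
          rintro _ ⟨z, hz, rfl⟩
          exact Rect.star_mem_cpts w1 hP hz)
    refine control_mem_of_refinements hS hn [a] fun V h hb =>
      ⟨[[(A.res h (star a), P')]], ?_, fun φ hφ hx => ⟨_, List.mem_singleton.2 rfl, ?_⟩⟩
    · intro t ht
      obtain rfl := List.mem_singleton.1 ht
      exact ⟨_, rfl, refines_singleton w3 h⟩
    · intro x hx'
      obtain rfl := List.mem_singleton.1 hx'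
      rw [A.star_res, hφ.map_star _ (hb a (by simp))]
      exact h3 ⟨_, R₁.cpts_subset_box (hx _ h1), rfl⟩

/-- The open of `MFn(A)` formed by the finite meets of generators on which `|b| < q` in the sense of
`ControlOn`. -/
def controlOpen (b : A.El U) (q : PosRat) : A.MFn.Opens J U where
  mem V f l := ControlOn b q f l
  mem_res V W f g l h := h.res g
  mem_glue V f l S hS h := by
    intro W g m hm
    refine J.transitive (J.pullback_stable g hS) _ fun V' k hk => ?_
    have hm' := hm.res k
    rw [← Presentation.Opens.res_comp, ← Presentation.Opens.res_id (A.MFn.res (k ≫ g) l)] at hm'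
    have := h (k ≫ g) hk (𝟙 V') _ hm'
    rwa [Category.id_comp, Category.assoc, ← pullback_control] at this
  mem_mono V f l l' hl h W g m hm := h g m fun x hx => hm x (List.map_subset _ hl hx)
  mem_cover V f m n S hS h W g m' hm := by
    rw [Presentation.Opens.res_append] at hm
    refine control_mem_of_rel (A.MFn.rel_res g m S hS) ?_ hm
    rintro _ ⟨l, hl, rfl⟩
    have := (h l hl).res g
    rwa [Presentation.Opens.res_append] at this

theorem invDisc_le_controlOpen (b : A.El U) (q : PosRat) :
    (A.gelfand b).invDisc q ≤ controlOpen b q := by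
  refine iSup_le fun R => (Presentation.Opens.basic_le_iff (X := A.MFn) _ _).2 ?_
  intro V g m hm
  obtain ⟨R', h1, h2⟩ := hm (A.res g b, R.1) (mem_res_iff.2 ⟨_, List.mem_singleton.2 rfl, rfl⟩)
  refine J.superset_covering (fun W h _ φ hφ hx => ?_) (J.top_mem V)
  refine Rect.norm_lt_of_mem_cpts q.2 R.2 (h2.box_subset (R'.cpts_subset_box ?_))
  rw [Category.comp_id, res_comp]
  exact hx _ h1

theorem normLT_gelfand_le (b : A.El U) (q : PosRat) :
    (A.gelfand b).normLT q ≤ (A.norm b).lt q := by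
  intro V f hf
  have h0 : ControlOn b q f [] := invDisc_le_controlOpen b q f [] hf
  have h1 := h0 (𝟙 V) [] (fun x hx => absurd hx List.not_mem_nil)
  rw [Category.id_comp] at h1
  obtain ⟨S, hS, hb⟩ := cover_bounded A.toCStarSeminormed V (A.res f b)
  refine (normLT_res f).1 (normLT_of_cover (J.intersection_covering h1 hS) fun W g hg => ?_)
  refine normLT_of_forall_character (hb g hg.2) fun φ hφ => ?_
  have := hg.1 φ hφ fun x hx => absurd hx List.not_mem_nil
  rwa [res_comp] at this

end CommCStarAlgebra

/-! ### A bound on the norm gives a bound on the Gelfand transform -/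

namespace Rect

/-- The image of a rectangle under conjugation. -/
def conj (R : Rect) : Rect := ⟨⟨R.lo.re, -R.hi.im⟩, ⟨R.hi.re, -R.lo.im⟩⟩

theorem star_mem_conj {R : Rect} {z : CRat} (h : z ∈ R.pts) : star z ∈ R.conj.pts := by
  obtain ⟨h1, h2, h3, h4⟩ := h
  refine ⟨?_, ?_, ?_, ?_⟩ <;> simp [conj] <;> assumption

theorem lt_mul_of_near {x₀ x x' δ K : ℚ} (h₀ : |x₀| < K) (h : |x - x₀| < δ) (h' : |x' - x₀| < δ) :
    x₀ ^ 2 - 2 * K * δ - δ ^ 2 < x * x' := by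
  have key : ∀ {a b c d : ℚ}, |a| < c → |b| < d → |a * b| < c * d := fun ha hb => by
    rw [abs_mul]
    exact mul_lt_mul'' ha hb (abs_nonneg _) (abs_nonneg _)
  have h1 := (abs_lt.1 (key h₀ h)).1
  have h2 := (abs_lt.1 (key h₀ h')).1
  have h3 := (abs_lt.1 (key h h')).1
  linarith [show x * x' = x₀ ^ 2 + x₀ * (x - x₀) + x₀ * (x' - x₀) + (x - x₀) * (x' - x₀) by ring]

theorem exists_abs_lt (R : Rect) : ∃ K : ℚ, 0 < K ∧ ∀ z ∈ R.pts, |z.re| < K ∧ |z.im| < K := by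
  refine ⟨|R.lo.re| + |R.hi.re| + |R.lo.im| + |R.hi.im| + 1, by positivity, ?_⟩
  rintro z ⟨h1, h2, h3, h4⟩
  have := abs_le.1 (le_refl |R.lo.re|)
  have := abs_le.1 (le_refl |R.hi.re|)
  have := abs_le.1 (le_refl |R.lo.im|)
  have := abs_le.1 (le_refl |R.hi.im|)
  exact ⟨abs_lt.2 ⟨by linarith, by linarith⟩, abs_lt.2 ⟨by linarith, by linarith⟩⟩

/-- Products of points of two rectangles lie in a rectangle, whose left side may be put at any strict
lower bound for the real parts of these products. -/
theorem exists_mul_subset {R S : Rect} {c : ℚ}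
    (h : ∀ z ∈ R.pts, ∀ z' ∈ S.pts, c < (z * z').re) :
    ∃ P : Rect, P.lo.re = c ∧ ∀ z ∈ R.pts, ∀ z' ∈ S.pts, z * z' ∈ P.pts := by
  obtain ⟨K, hK, h1⟩ := R.exists_abs_lt
  obtain ⟨L, hL, h2⟩ := S.exists_abs_lt
  refine ⟨⟨⟨c, -(2 * (K * L))⟩, ⟨2 * (K * L), 2 * (K * L)⟩⟩, rfl, fun z hz z' hz' => ?_⟩
  have key : ∀ {a b : ℚ}, |a| < K → |b| < L → |a * b| < K * L := fun ha hb => by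
    rw [abs_mul]
    exact mul_lt_mul'' ha hb (abs_nonneg _) (abs_nonneg _)
  have k1 := abs_lt.1 (key (h1 z hz).1 (h2 z' hz').1)
  have k2 := abs_lt.1 (key (h1 z hz).2 (h2 z' hz').2)
  have k3 := abs_lt.1 (key (h1 z hz).1 (h2 z' hz').2)
  have k4 := abs_lt.1 (key (h1 z hz).2 (h2 z' hz').1)
  refine ⟨h z hz z' hz', ?_, ?_, ?_⟩ <;>
    simp only [QuadraticAlgebra.re_mul, QuadraticAlgebra.im_mul] <;> linarith

end Rect

namespace CommCStarAlgebra

open CStarSeminormed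

variable {A : CommCStarAlgebra.{w} J} {U V W : C}

theorem singleton_subset {α : Type*} {x : α} {n : List α} (hx : x ∈ n) : [x] ⊆ n :=
  List.cons_subset.2 ⟨hx, List.nil_subset n⟩

theorem pair_subset {α : Type*} {x y : α} {n : List α} (hx : x ∈ n) (hy : y ∈ n) : [x, y] ⊆ n :=
  List.cons_subset.2 ⟨hx, singleton_subset hy⟩

section

variable {O : A.MFn.Opens J U} {f : V ⟶ U}

/-- To show that `⋀ n` lies in an open, a relation whose left hand side is part of `n` may be
used. -/
theorem mem_of_rel {m n : A.MFn.Fin V} {S : Set (A.MFn.Fin V)} (h : A.MFnRel V m S) (hmn : m ⊆ n)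
    (H : ∀ l ∈ S, O.mem f (l ++ n)) : O.mem f n :=
  O.mem_mono f _ _ (List.append_subset.2 ⟨hmn, List.Subset.refl n⟩) (O.mem_cover f m n S h H)

theorem mem_of_rel_singleton {m n l : A.MFn.Fin V} (h : A.MFnRel V m {l}) (hmn : m ⊆ n)
    (H : O.mem f (l ++ n)) : O.mem f n :=
  mem_of_rel h hmn fun l' hl' => by rwa [Set.mem_singleton_iff.1 hl']

theorem mem_of_total (a : A.El V) {n : A.MFn.Fin V}
    (H : ∀ R : Rect, O.mem f ((a, R) :: n)) : O.mem f n :=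
  mem_of_rel (.complex a _ _ .total) (List.nil_subset _) (by rintro _ ⟨R, rfl⟩; exact H R)

theorem mem_of_cover {a : A.El V} {R : Rect} {L : List Rect}
    (hL : ∀ z ∈ R.pts, ∃ P ∈ L, z ∈ P.pts) {n : A.MFn.Fin V} (hn : ((a, R) : A.El V × Rect) ∈ n)
    (H : ∀ P ∈ L, O.mem f ((a, P) :: n)) : O.mem f n :=
  mem_of_rel (.complex a _ _ (.cover R L hL)) (singleton_subset hn)
    (by rintro _ ⟨P, hP, rfl⟩; exact H P hP)

/-- Disjoint rectangles are disjoint as constraints on the same element. -/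
theorem mem_of_disjoint {a : A.El V} {R R' : Rect} (h : ∀ z ∈ R.pts, z ∉ R'.pts)
    {n : A.MFn.Fin V} (hR : ((a, R) : A.El V × Rect) ∈ n)
    (hR' : ((a, R') : A.El V × Rect) ∈ n) : O.mem f n := by
  refine mem_of_rel_singleton (.complex a _ _ (.inter R R')) (pair_subset hR hR') ?_
  refine mem_of_cover (L := []) (fun z hz => ?_) List.mem_cons_self (by simp)
  obtain ⟨h1, h2, h3, h4⟩ := hz
  exact absurd ⟨(le_max_right _ _).trans_lt h1, h2.trans_le (min_le_right _ _),
    (le_max_right _ _).trans_lt h3, h4.trans_le (min_le_right _ _)⟩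
    (h z ⟨(le_max_left _ _).trans_lt h1, h2.trans_le (min_le_left _ _),
      (le_max_left _ _).trans_lt h3, h4.trans_le (min_le_left _ _)⟩)

/-- If `y² + b b* = s` with `y` selfadjoint, then `b` lies in no small rectangle that has a point
outside a disc of square radius greater than `s`: on such a rectangle `b b*` is greater than `s`,
whereas the real part of `y²` is nearly non negative. -/
theorem mem_of_far {b y : A.El V} (hy : star y = y) {s : ℚ}
    (hs : y * y + b * star b = algebraMap CRat (A.El V) (algebraMap ℚ CRat s))
    {P Q : Rect} {δ K t : ℚ} (hδ : 0 < δ) (hP : P.hi.re - P.lo.re ≤ δ ∧ P.hi.im - P.lo.im ≤ δ)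
    (hQ : Q.hi.re - Q.lo.re ≤ δ ∧ Q.hi.im - Q.lo.im ≤ δ) {z₀ : CRat} (hz₀ : z₀ ∈ P.pts)
    (hz₀K : |z₀.re| < K ∧ |z₀.im| < K) (hz₀t : t ≤ z₀.re ^ 2 + z₀.im ^ 2)
    (hst : s < t - 4 * K * δ - 3 * δ ^ 2) {n : A.MFn.Fin V}
    (hbn : ((b, P) : A.El V × Rect) ∈ n) (hyn : ((y, Q) : A.El V × Rect) ∈ n) : O.mem f n := by
  -- the location of `b b*`
  obtain ⟨H, hH, hH'⟩ := Rect.exists_mul_subset (R := P) (S := P.conj)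
    (c := t - 4 * K * δ - 2 * δ ^ 2) fun z hz z' hz' => by
      obtain ⟨h1, h2, h3, h4⟩ := hz
      obtain ⟨k1, k2, k3, k4⟩ := hz'
      obtain ⟨m1, m2, m3, m4⟩ := hz₀
      simp only [Rect.conj] at k1 k2 k3 k4
      have e1 := Rect.lt_mul_of_near (x := z.re) (x' := z'.re) (δ := δ) hz₀K.1
        (abs_lt.2 ⟨by linarith, by linarith⟩) (abs_lt.2 ⟨by linarith, by linarith⟩)
      have e2 := Rect.lt_mul_of_near (x := z.im) (x' := -z'.im) (δ := δ) hz₀K.2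
        (abs_lt.2 ⟨by linarith, by linarith⟩) (abs_lt.2 ⟨by linarith, by linarith⟩)
      rw [QuadraticAlgebra.re_mul]
      linarith
  -- the location of `y²`, given that `y = y*` also lies in the conjugate of `Q`
  obtain ⟨H₁, hH₁, hH₁'⟩ := Rect.exists_mul_subset (R := Q.inter Q.conj) (S := Q.inter Q.conj)
    (c := -δ ^ 2) fun z hz z' hz' => by
      obtain ⟨h1, h2, h3, h4⟩ := hz
      obtain ⟨k1, k2, k3, k4⟩ := hz'
      simp only [Rect.inter, Rect.conj, max_self, min_self, max_lt_iff, lt_min_iff]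
        at h1 h2 h3 h4 k1 k2 k3 k4
      have e1 : |z.re - z'.re| < δ := abs_lt.2 ⟨by linarith, by linarith⟩
      have e2 : |z.im| < δ / 2 := abs_lt.2 ⟨by linarith, by linarith⟩
      have e3 : |z'.im| < δ / 2 := abs_lt.2 ⟨by linarith, by linarith⟩
      have e4 := mul_lt_mul'' e2 e3 (abs_nonneg _) (abs_nonneg _)
      rw [← abs_mul] at e4
      have e5 := (le_abs_self _).trans_lt e4
      have e6 := sq_lt_sq' (abs_lt.1 e1).1 (abs_lt.1 e1).2
      rw [QuadraticAlgebra.re_mul]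
      nlinarith [sq_nonneg (z.re + z'.re)]
  let T : Rect := ⟨H₁.lo + H.lo, H₁.hi + H.hi⟩
  let T' : Rect := ⟨⟨s - 1, -1⟩, ⟨T.lo.re, 1⟩⟩
  have hT : T.lo.re = t - 4 * K * δ - 3 * δ ^ 2 := by
    change H₁.lo.re + H.lo.re = _
    rw [hH, hH₁]
    ring
  refine mem_of_rel_singleton (.star b P P.conj fun z => Rect.star_mem_conj)
    (singleton_subset hbn) ?_
  refine mem_of_rel_singleton (.mul b (star b) P P.conj H hH')
    (pair_subset (List.mem_cons_of_mem _ hbn) List.mem_cons_self) ?_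
  have hyn' := List.mem_cons_of_mem (b * star b, H) (List.mem_cons_of_mem (star b, P.conj) hyn)
  refine mem_of_rel_singleton (.star y Q Q.conj fun z => Rect.star_mem_conj)
    (singleton_subset hyn') ?_
  rw [hy]
  refine mem_of_rel_singleton (.complex y _ _ (.inter Q Q.conj))
    (pair_subset (List.mem_cons_of_mem _ hyn') List.mem_cons_self) ?_
  refine mem_of_rel_singleton (.mul y y _ _ H₁ hH₁')
    (pair_subset List.mem_cons_self List.mem_cons_self) ?_
  refine mem_of_rel_singleton (.add (y * y) (b * star b) H₁ H T fun z hz z' hz' =>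
    ⟨add_lt_add hz.1 hz'.1, add_lt_add hz.2.1 hz'.2.1, add_lt_add hz.2.2.1 hz'.2.2.1,
      add_lt_add hz.2.2.2 hz'.2.2.2⟩) (pair_subset List.mem_cons_self ?_) ?_
  · exact List.mem_cons_of_mem _ (List.mem_cons_of_mem _ (List.mem_cons_of_mem _ List.mem_cons_self))
  refine mem_of_rel_singleton (.scalar (algebraMap ℚ CRat s) T' ?_) (List.nil_subset _) ?_
  · refine ⟨?_, ?_, ?_, ?_⟩ <;> simp only [T', QuadraticAlgebra.algebraMap_eq] <;> linarith
  rw [hs]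
  exact mem_of_disjoint (fun z hz hz' => lt_asymm hz.2.1 hz'.1) List.mem_cons_self
    (List.mem_cons_of_mem _ List.mem_cons_self)

/-- If `‖b‖ < r < q`, then any open that contains all `b ∈ R`, for `R` a rectangle in the disc of
radius `q`, is everything. -/
theorem mem_nil_of_normLT {b : A.El V} {q r : PosRat} (hb : A.NormLT b r) (hr : r < q)
    (H : ∀ R : Rect, (∀ z ∈ R.pts, z.re ^ 2 + z.im ^ 2 < q.1 ^ 2) → O.mem f [(b, R)]) :
    O.mem f [] := by
  obtain ⟨y, hy, hs⟩ := exists_selfAdjoint_sq hb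
  refine mem_of_total b fun R => ?_
  obtain ⟨K, hK, hR⟩ := R.exists_abs_lt
  have hgap : 0 < q.1 ^ 2 - r.1 * r.1 := by
    have h1 : r.1 < q.1 := hr
    have h2 := r.2
    nlinarith
  -- small enough for `(4 K + 3) δ < q² - r²`
  obtain ⟨δ, hδ, hδ'⟩ : ∃ δ : ℚ, 0 < δ ∧ r.1 * r.1 < q.1 ^ 2 - 4 * K * δ - 3 * δ ^ 2 := by
    set g := q.1 ^ 2 - r.1 * r.1 with hg
    have hD : 0 < 4 * K + 3 + g := by positivity
    have h1 : g / (4 * K + 3 + g) * (4 * K + 3 + g) = g := div_mul_cancel₀ g hD.ne'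
    have h2 : 0 < g / (4 * K + 3 + g) := by positivity
    have h3 : g / (4 * K + 3 + g) < 1 := (div_lt_one hD).2 (by linarith)
    refine ⟨g / (4 * K + 3 + g), h2, ?_⟩
    generalize g / (4 * K + 3 + g) = δ at h1 h2 h3
    nlinarith [mul_pos h2 hgap]
  obtain ⟨L, hL, hL'⟩ := R.exists_fine_cover hδ
  refine mem_of_cover hL List.mem_cons_self fun P hP => ?_
  by_cases hPq : ∀ z ∈ P.pts, z.re ^ 2 + z.im ^ 2 < q.1 ^ 2
  · exact O.mem_mono f _ _ (singleton_subset List.mem_cons_self) (H P hPq)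
  push Not at hPq
  obtain ⟨z₀, hz₀, hz₀q⟩ := hPq
  refine mem_of_total y fun R' => ?_
  obtain ⟨M, hM, hM'⟩ := R'.exists_fine_cover hδ
  refine mem_of_cover hM List.mem_cons_self fun Q hQ => ?_
  exact mem_of_far hy hs hδ (hL' P hP).2 (hM' Q hQ).2 hz₀ (hR z₀ ((hL' P hP).1 hz₀)) hz₀q hδ'
    (List.mem_cons_of_mem _ (List.mem_cons_of_mem _ List.mem_cons_self)) List.mem_cons_self

end

theorem le_normLT_gelfand (b : A.El U) (q : PosRat) :
    (A.norm b).lt q ≤ (A.gelfand b).normLT q := by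
  intro V f hf
  refine ((A.gelfand b).invDisc q).mem_glue f [] _ ((A.norm b).rounded q f hf) fun W g hg => ?_
  obtain ⟨_, ⟨r, rfl⟩, hr⟩ := hg
  refine mem_nil_of_normLT ((normLT_res (g ≫ f)).2 hr) r.2 fun R hR => ?_
  have h := (Presentation.Opens.basic_le_iff (X := A.MFn) _ _).1
    (le_iSup (fun R : {R : Rect // ∀ z ∈ R.pts, z.re ^ 2 + z.im ^ 2 < q.1 ^ 2} =>
      (A.gelfand b).inv R.1) ⟨R, hR⟩)
  have h' := ((A.gelfand b).invDisc q).mem_res (𝟙 U) (g ≫ f) _ h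
  rwa [Category.comp_id] at h'

end CommCStarAlgebra

end ToposGelfand

theorem theorem5p1 {C : Type u} [Category.{v} C] (J : GrothendieckTopology C)
    (A : ToposGelfand.CommCStarAlgebra.{w} J) (U : C) (b : A.El U) (q : ToposGelfand.PosRat) :
    (A.norm b).lt q = (A.gelfand b).normLT q :=
  le_antisymm (ToposGelfand.CommCStarAlgebra.le_normLT_gelfand b q)
    (ToposGelfand.CommCStarAlgebra.normLT_gelfand_le b q)
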